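/- **Setting.** Let $(\Omega,\mathcal F,P)$ be a complete probability space with a filtration $(\mathcal F_t)_{t\ge0}$ satisfying the usual conditions, let $H$ and $G$ be separable real Hilbert spaces, $U$ a topological space, and $T>0$. $\mathcal L_2(H,G)$ denotes the Hilbert–Schmidt operators. For a continuous Hilbertian seminorm $q$ on $H$, $H_q$ is the Hilbert space completion of $(H/\ker q,q)$ and $i_q:H\to H_q$ is the canonical map. $\mathcal M^2_T(G)$ is the space of $G$-valued mean-zero càdlàg square integrable martingales on $[0,T]$ (indistinguishable processes are identified) with norm $\|X\|_{\mathcal M^2_T(G)}=(E\sup_{t\le T}\|X_t\|^2)^{1/2}$. Let $\mathcal R$ be a ring of sets generating $\mathcal B(U)$ and let $M=(M(t,A):t\ge0,A\in\mathcal R)$ be a cylindrical martingale-valued measure in $H$: a family of linear maps $M(t,A):H\to L^0(\Omega,\mathcal F,P)$ such that, a.s. equalities being understood, 1. $M(0,A)(h)=0$ for all $A\in\mathcal R$, $h\in H$; 2. $M(t,\emptyset)(h)=0$, and $M(t,A\cup B)(h)=M(t,A)(h)+M(t,B)(h)$ for disjoint $A,B\in\mathcal R$; 3. for all $A\in\mathcal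 R$ and $h\in H$, $(M(t,A)(h))_{t\ge0}$ is a real mean-zero square integrable martingale, and $M(t,A):H\to L^0$ is continuous for convergence in probability; 4. $E[M(t,A)(h_1)M(s,B)(h_2)]=0$ for disjoint $A,B\in\mathcal R$ and all $t,s\ge0$, $h_1,h_2\in H$; 5. writing $M((s,t],A)=M(t,A)-M(s,A)$, for all $0\le s<t$, $A,B\in\mathcal R$, $h_1,h_2\in H$ the random vector $\big(M((s,t],A)(h_1),M((s,t],B)(h_2)\big)$ is independent of $\mathcal F_s$; 6. for all $A\in\mathcal R$, $0\le s<t$, $h\in H$: $E|M((s,t],A)(h)|^2=\int_{(s,t]}\int_A q_{r,u}(h)^2\,\mu(du)\,\lambda(dr)$, where $\mu$ is a $\sigma$-finite Borel measure on $U$, finite on $\mathcal R$, $\lambda$ is a Borel measure on $\mathbb R_+$, finite on bounded intervals, and $(q_{r,u})$ are continuous Hilbertian seminorms on $H$ such that for all $h_1,h_2\in H$ the associated bilinear forms $(r,u)\mapsto q_{r,u}(h_1,h_2)$ are jointly measurable and bounded on $[0,T']\times U$ for every $T'>0$. **Simple integrands.** $\mathcal S(M,T)$ is the vector space of families $$\Phi(r,\omega,u)=\sum_{i=1}^n\sum_{j=1}^m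 1_{]s_i,t_i]}(r)\,1_{F_i}(\omega)\,1_{A_j}(u)\;S_{i,j}\circ i^*_{q_{r,u}}\qquad(r\in[0,T],\ \omega\in\Omega,\ u\in U),\tag{a}$$ with $0\le s_i<t_i\le T$, $F_i\in\mathcal F_{s_i}$, $A_j\in\mathcal R$, $S_{i,j}\in\mathcal L_2(H,G)$, with the (semi)norm given by $\|\Phi\|^2_{\Lambda^2(M,T)}=E\int_0^T\!\int_U\|\Phi(r,u)\|^2_{\mathcal L_2(H_{q_{r,u}},G)}\,\mu(du)\,\lambda(dr)$. The representation (a) is called separated if, whenever $k\ne l$ and $]s_k,t_k]\cap]s_l,t_l]\neq\emptyset$, one has $]s_k,t_k]=]s_l,t_l]$ and $F_k\cap F_l=\emptyset$. **Radonified processes.** For $0\le s<t\le T$, $A\in\mathcal R$ and $S\in\mathcal L_2(H,G)$, $Y(s,t,A,S)$ denotes a $G$-valued càdlàg square integrable martingale on $[0,T]$ such that, for all $r\in[0,T]$ and $g\in G$, a.s. $\langle Y_r(s,t,A,S),g\rangle=M((s\wedge r,t\wedge r],A)(S^*g)$. **Theorem.** The process $Y(s,t,A,S)$ exists for all such $s,t,A,S$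 and is unique up to indistinguishability. Every $\Phi\in\mathcal S(M,T)$ has a separated representation, and the process $$I_t(\Phi)=\sum_{i=1}^n\sum_{j=1}^m 1_{F_i}\,Y_t(s_i,t_i,A_j,S_{i,j}),\qquad t\in[0,T],$$ does not depend, up to indistinguishability, on the separated representation (a) of $\Phi$ by which it is computed. For every $\Phi\in\mathcal S(M,T)$ one has $I(\Phi)\in\mathcal M^2_T(G)$, and for every $t\in[0,T]$ $$E\,I_t(\Phi)=0,\qquad E\|I_t(\Phi)\|^2=E\int_0^t\!\int_U\|\Phi(r,u)\|^2_{\mathcal L_2(H_{q_{r,u}},G)}\,\mu(du)\,\lambda(dr),$$ where $\int_0^t=\int_{(0,t]}$. In particular $I:\mathcal S(M,T)\to\mathcal M^2_T(G)$ is linear and continuous, i.e. linear with $\|I(\Phi)\|_{\mathcal M^2_T(G)}\le C\|\Phi\|_{\Lambda^2(M,T)}$ for some constant $C$ and all $\Phi$. -/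

import Mathlib

open MeasureTheory ProbabilityTheory Filter Topology Set
open scoped NNReal ENNReal RealInnerProductSpace

noncomputable section

/-! ### Hilbert–Schmidt operators -/

section HilbertSchmidt

variable {E F : Type*} [NormedAddCommGroup E] [InnerProductSpace ℝ E] [CompleteSpace E]
  [NormedAddCommGroup F] [InnerProductSpace ℝ F]

/-- A chosen complete orthonormal system of a Hilbert space. -/
def chosenONB (E : Type*) [NormedAddCommGroup E] [InnerProductSpace ℝ E] [CompleteSpace E] :
    Set E :=
  (exists_hilbertBasis ℝ E).choose

/-- The squared Hilbert–Schmidt norm `∑ₙ ‖S eₙ‖²`, with values in `[0, ∞]`. It does not depend on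
the complete orthonormal system, see `hsNormSq_eq_tsum`. -/
def hsNormSq (S : E →L[ℝ] F) : ℝ≥0∞ := ∑' e : chosenONB E, ‖S (e : E)‖ₑ ^ 2

/-- `S` belongs to `L₂(E, F)`. -/
def IsHilbertSchmidt (S : E →L[ℝ] F) : Prop := hsNormSq S < ∞

theorem enorm_sq_eq_tsum_inner {V ι : Type*} [NormedAddCommGroup V] [InnerProductSpace ℝ V]
    (b : HilbertBasis ι ℝ V) (x : V) :
    ‖x‖ₑ ^ 2 = ∑' i, ‖⟪x, b i⟫‖ₑ ^ 2 := by
  have h := b.hasSum_inner_mul_inner x x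
  have h2 : (fun i => ⟪x, b i⟫ * ⟪b i, x⟫) = fun i => ‖⟪x, b i⟫‖ ^ 2 := by
    funext i
    rw [real_inner_comm x (b i), Real.norm_eq_abs, sq_abs, sq]
  rw [h2, real_inner_self_eq_norm_sq] at h
  have h3 : ∀ y : ℝ, ‖y‖ₑ ^ 2 = ENNReal.ofReal (‖y‖ ^ 2) := fun y => by
    rw [← ofReal_norm, ENNReal.ofReal_pow (norm_nonneg _)]
  simp_rw [h3]
  rw [← ENNReal.ofReal_tsum_of_nonneg (fun i => by positivity) h.summable, h.tsum_eq,
    ← ofReal_norm, ENNReal.ofReal_pow (norm_nonneg _)]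

theorem tsum_enorm_sq_eq_adjoint [CompleteSpace F] {ι κ : Type*} (b : HilbertBasis ι ℝ E) (c : HilbertBasis κ ℝ F)
    (S : E →L[ℝ] F) :
    ∑' i, ‖S (b i)‖ₑ ^ 2 = ∑' k, ‖ContinuousLinearMap.adjoint S (c k)‖ₑ ^ 2 := by
  simp_rw [enorm_sq_eq_tsum_inner c (S _),
    enorm_sq_eq_tsum_inner b (ContinuousLinearMap.adjoint S _),
    ContinuousLinearMap.adjoint_inner_left]
  rw [ENNReal.tsum_comm]
  simp_rw [real_inner_comm]

/-- The Hilbert–Schmidt norm can be computed in any complete orthonormal system. -/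
theorem hsNormSq_eq_tsum [CompleteSpace F] {ι : Type*} (b : HilbertBasis ι ℝ E) (S : E →L[ℝ] F) :
    hsNormSq S = ∑' i, ‖S (b i)‖ₑ ^ 2 := by
  obtain ⟨e, he⟩ := (exists_hilbertBasis ℝ E).choose_spec
  obtain ⟨w, c, -⟩ := exists_hilbertBasis ℝ F
  rw [tsum_enorm_sq_eq_adjoint b c, ← tsum_enorm_sq_eq_adjoint e c, he]
  rfl

theorem IsHilbertSchmidt.zero : IsHilbertSchmidt (0 : E →L[ℝ] F) := by
  simp [IsHilbertSchmidt, hsNormSq]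

theorem IsHilbertSchmidt.smul {S : E →L[ℝ] F} (hS : IsHilbertSchmidt S) (a : ℝ) :
    IsHilbertSchmidt (a • S) := by
  unfold IsHilbertSchmidt hsNormSq at *
  simp only [_root_.smul_apply, enorm_smul, mul_pow, ENNReal.tsum_mul_left]
  exact ENNReal.mul_lt_top (by simp) hS

end HilbertSchmidt

/-! ### Continuous Hilbertian seminorms and their Hilbert spaces -/

/-- A continuous Hilbertian seminorm on `H`, given by its positive symmetric bilinear form. -/
structure HilbertianSeminorm (H : Type*) [NormedAddCommGroup H] [InnerProductSpace ℝ H] where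
  form : H →ₗ[ℝ] H →ₗ[ℝ] ℝ
  symm : ∀ x y, form x y = form y x
  nonneg : ∀ x, 0 ≤ form x x
  continuous_sqrt : Continuous fun x => √(form x x)

namespace HilbertianSeminorm

variable {H : Type*} [NormedAddCommGroup H] [InnerProductSpace ℝ H]

/-- The value `q(h)` of the seminorm. -/
def val (q : HilbertianSeminorm H) (h : H) : ℝ := √(q.form h h)

/-- The vector space `H` carrying the seminorm `q` instead of its norm. -/
def Pre (_q : HilbertianSeminorm H) : Type _ := H

instance (q : HilbertianSeminorm H) : AddCommGroup q.Pre := inferInstanceAs (AddCommGroup H)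

instance (q : HilbertianSeminorm H) : Module ℝ q.Pre := inferInstanceAs (Module ℝ H)

@[reducible] def core (q : HilbertianSeminorm H) : PreInnerProductSpace.Core ℝ q.Pre where
  inner x y := q.form x y
  conj_inner_symm x y := q.symm y x
  re_inner_nonneg x := q.nonneg x
  add_left x y z := by
    exact q.form.map_add₂ (x : H) (y : H) (z : H)
  smul_left x y r := by
    exact q.form.map_smul₂ r (x : H) (y : H)

instance (q : HilbertianSeminorm H) : SeminormedAddCommGroup q.Pre :=
  @InnerProductSpace.Core.toSeminormedAddCommGroup ℝ q.Pre _ _ _ q.core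

instance (q : HilbertianSeminorm H) : InnerProductSpace ℝ q.Pre :=
  InnerProductSpace.ofCore q.core

/-- The Hilbert space `H_q`: the Hausdorff completion of `(H, q)`, that is, the completion of the
pre-Hilbert space `H / ker q`. -/
abbrev Space (q : HilbertianSeminorm H) : Type _ := UniformSpace.Completion q.Pre

/-- The identity of `H`, as a continuous linear map from `H` to `(H, q)`. -/
def toPre (q : HilbertianSeminorm H) : H →L[ℝ] q.Pre where
  toFun h := h
  map_add' _ _ := rfl
  map_smul' _ _ := rfl
  cont := by
    let f : H →+ q.Pre := { toFun := fun h => h, map_zero' := rfl, map_add' := fun _ _ => rfl }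
    change Continuous f
    refine continuous_of_continuousAt_zero f ?_
    have h : Tendsto (fun x => √(q.form x x)) (𝓝 0) (𝓝 0) := by
      simpa using q.continuous_sqrt.tendsto 0
    unfold ContinuousAt
    rw [map_zero]
    exact tendsto_zero_iff_norm_tendsto_zero.mpr h

/-- The canonical map `i_q : H → H_q`. -/
def incl (q : HilbertianSeminorm H) : H →L[ℝ] q.Space :=
  (UniformSpace.Completion.toComplL : q.Pre →L[ℝ] q.Space).comp q.toPre

theorem norm_incl (q : HilbertianSeminorm H) (h : H) : ‖q.incl h‖ = q.val h :=
  UniformSpace.Completion.norm_coe (E := q.Pre) _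

end HilbertianSeminorm

/-! ### Square integrable càdlàg martingales on `[0, T]` -/

section Martingales

variable {Ω : Type*} {mΩ : MeasurableSpace Ω}

/-- The usual conditions: right continuity, and `𝓕₀` contains every `P`-null set (measurable or
not, so that `P` is complete). -/
structure UsualConditions (P : Measure Ω) (ℱ : Filtration ℝ≥0 mΩ) : Prop where
  rightContinuous : ℱ.IsRightContinuous
  null_mem : ∀ N : Set Ω, P N = 0 → MeasurableSet[ℱ 0] N

/-- The restriction of a filtration to the time interval `[0, T]`. -/
def restrictTime (ℱ : Filtration ℝ≥0 mΩ) (T : ℝ≥0) : Filtration (Iic T) mΩ where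
  seq t := ℱ (t : ℝ≥0)
  mono' _ _ h := ℱ.mono h
  le' t := ℱ.le t

/-- `f : [0, T] → G` is right continuous and has left limits. -/
def IsCadlag {T : ℝ≥0} {G : Type*} [TopologicalSpace G] (f : Iic T → G) : Prop :=
  ∀ t, ContinuousWithinAt f (Ici t) t ∧ ∃ l, Tendsto f (𝓝[<] t) (𝓝 l)

variable {G : Type*} [NormedAddCommGroup G] [InnerProductSpace ℝ G] [CompleteSpace G]

/-- `X` is a `G`-valued càdlàg square integrable martingale on `[0, T]`. -/
structure IsCadlagL2Martingale (P : Measure Ω) (ℱ : Filtration ℝ≥0 mΩ) (T : ℝ≥0)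
    (X : Iic T → Ω → G) : Prop where
  martingale : Martingale X (restrictTime ℱ T) P
  memLp : ∀ t, MemLp (X t) 2 P
  cadlag : ∀ ω, IsCadlag fun t => X t ω

/-- The vector space of `G`-valued mean-zero càdlàg square integrable martingales on `[0, T]`. -/
def l2Martingales (P : Measure Ω) [IsFiniteMeasure P] (ℱ : Filtration ℝ≥0 mΩ) (T : ℝ≥0)
    (G : Type*) [NormedAddCommGroup G] [InnerProductSpace ℝ G] [CompleteSpace G] :
    Submodule ℝ (Iic T → Ω → G) where
  carrier := {X | IsCadlagL2Martingale P ℱ T X ∧ ∀ t, ∫ ω, X t ω ∂P = 0}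
  zero_mem' :=
    ⟨⟨martingale_zero _ _ _, fun _ => MemLp.zero', fun _ _ =>
      ⟨continuousWithinAt_const, 0, tendsto_const_nhds⟩⟩, fun _ => by simp⟩
  add_mem' := by
    rintro X Y ⟨hX, hX0⟩ ⟨hY, hY0⟩
    refine ⟨⟨hX.martingale.add hY.martingale, fun t => (hX.memLp t).add (hY.memLp t),
      fun ω t => ⟨(hX.cadlag ω t).1.add (hY.cadlag ω t).1, ?_⟩⟩, fun t => ?_⟩
    · obtain ⟨a, ha⟩ := (hX.cadlag ω t).2
      obtain ⟨b, hb⟩ := (hY.cadlag ω t).2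
      exact ⟨a + b, ha.add hb⟩
    · simp only [Pi.add_apply]
      rw [integral_add (hX.martingale.integrable t) (hY.martingale.integrable t), hX0, hY0, add_zero]
  smul_mem' := by
    rintro c X ⟨hX, hX0⟩
    refine ⟨⟨hX.martingale.smul c, fun t => (hX.memLp t).const_smul c,
      fun ω t => ⟨(hX.cadlag ω t).1.const_smul c, ?_⟩⟩, fun t => ?_⟩
    · obtain ⟨a, ha⟩ := (hX.cadlag ω t).2
      exact ⟨c • a, ha.const_smul c⟩
    · simp only [Pi.smul_apply]
      rw [integral_smul, hX0, smul_zero]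

/-- The martingales that are indistinguishable from zero. -/
def indistZero (P : Measure Ω) [IsFiniteMeasure P] (ℱ : Filtration ℝ≥0 mΩ) (T : ℝ≥0)
    (G : Type*) [NormedAddCommGroup G] [InnerProductSpace ℝ G] [CompleteSpace G] :
    Submodule ℝ (l2Martingales P ℱ T G) where
  carrier := {X | ∀ᵐ ω ∂P, ∀ t, (X : Iic T → Ω → G) t ω = 0}
  zero_mem' := by simp
  add_mem' := by
    intro X Y hX hY
    change ∀ᵐ ω ∂P, ∀ t, ((X + Y : l2Martingales P ℱ T G) : Iic T → Ω → G) t ω = 0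
    filter_upwards [hX, hY] with ω h1 h2 t
    simp [h1 t, h2 t]
  smul_mem' := by
    intro c X hX
    change ∀ᵐ ω ∂P, ∀ t, ((c • X : l2Martingales P ℱ T G) : Iic T → Ω → G) t ω = 0
    filter_upwards [hX] with ω h1 t
    simp [h1 t]

/-- The space `M²_T(G)` of `G`-valued mean-zero càdlàg square integrable martingales on `[0, T]`,
two indistinguishable processes being identified. -/
abbrev M2 (P : Measure Ω) [IsFiniteMeasure P] (ℱ : Filtration ℝ≥0 mΩ) (T : ℝ≥0)
    (G : Type*) [NormedAddCommGroup G] [InnerProductSpace ℝ G] [CompleteSpace G] : Type _ :=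
  l2Martingales P ℱ T G ⧸ indistZero P ℱ T G

/-- The norm `(E sup_{t ≤ T} ‖X_t‖²)^{1/2}` of `M²_T(G)`, with values in `[0, ∞]`. -/
def M2.norm {P : Measure Ω} [IsFiniteMeasure P] {ℱ : Filtration ℝ≥0 mΩ} {T : ℝ≥0}
    (X : M2 P ℱ T G) : ℝ≥0∞ :=
  Quotient.liftOn' X
    (fun X => (∫⁻ ω, ⨆ t, ‖(X : Iic T → Ω → G) t ω‖ₑ ^ 2 ∂P) ^ (1 / 2 : ℝ)) <| by
    intro X Y h
    have h' : ∀ᵐ ω ∂P, ∀ t, ((X - Y : l2Martingales P ℱ T G) : Iic T → Ω → G) t ω = 0 :=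
      (Submodule.quotientRel_def _).mp h
    congr 1
    refine lintegral_congr_ae ?_
    filter_upwards [h'] with ω hω
    refine iSup_congr fun t => ?_
    have := hω t
    simp only [Submodule.coe_sub, Pi.sub_apply, sub_eq_zero] at this
    rw [this]

end Martingales

/-! ### Cylindrical martingale-valued measures -/

/-- A cylindrical martingale-valued measure in `H` on `ℝ₊ × ring`. A cylindrical random variable is
a linear map from `H` to the space `L⁰(Ω, P)` of classes of random variables. Only the values
`M t A` with `A ∈ ring` matter. -/
structure CylMartingaleMeasure {Ω : Type*} {mΩ : MeasurableSpace Ω} (P : Measure Ω)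
    (ℱ : Filtration ℝ≥0 mΩ) (H : Type*) [NormedAddCommGroup H] [InnerProductSpace ℝ H]
    (U : Type*) [TopologicalSpace U] [MeasurableSpace U] where
  ring : Set (Set U)
  isSetRing : IsSetRing ring
  generateFrom_ring : MeasurableSpace.generateFrom ring = borel U
  M : ℝ≥0 → Set U → H →ₗ[ℝ] (Ω →ₘ[P] ℝ)
  zero_time : ∀ A ∈ ring, ∀ h, M 0 A h = 0
  empty : ∀ t h, M t ∅ h = 0
  union : ∀ t, ∀ A ∈ ring, ∀ B ∈ ring, Disjoint A B → ∀ h, M t (A ∪ B) h = M t A h + M t B h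
  martingale : ∀ A ∈ ring, ∀ h, Martingale (fun t ω => M t A h ω) ℱ P
  memLp : ∀ A ∈ ring, ∀ t h, MemLp (M t A h) 2 P
  mean_zero : ∀ A ∈ ring, ∀ t h, ∫ ω, M t A h ω ∂P = 0
  /-- `M t A : H → L⁰` is continuous for the topology of convergence in probability. -/
  continuous : ∀ A ∈ ring, ∀ t h₀, TendstoInMeasure P (fun h => ⇑(M t A h)) (𝓝 h₀) (M t A h₀)
  orthogonal : ∀ A ∈ ring, ∀ B ∈ ring, Disjoint A B → ∀ t s h₁ h₂,
    ∫ ω, M t A h₁ ω * M s B h₂ ω ∂P = 0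
  /-- Increments on `(s, t]` are independent of `ℱ s`; this is required of pairs of increments,
  and so includes the case of a single increment. -/
  indep : ∀ s t, s < t → ∀ A ∈ ring, ∀ B ∈ ring, ∀ h₁ h₂,
    Indep (MeasurableSpace.comap
      (fun ω => ((M t A - M s A) h₁ ω, (M t B - M s B) h₂ ω)) inferInstance) (ℱ s) P
  μ : Measure U
  sigmaFinite_μ : SigmaFinite μ
  μ_lt_top : ∀ A ∈ ring, μ A < ∞
  lam : Measure ℝ≥0
  lam_lt_top : ∀ t, lam (Iic t) < ∞
  q : ℝ≥0 → U → HilbertianSeminorm H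
  measurable_q : ∀ h₁ h₂, Measurable fun p : ℝ≥0 × U => (q p.1 p.2).form h₁ h₂
  bounded_q : ∀ (T : ℝ≥0) (h₁ h₂ : H), ∃ C : ℝ, ∀ r ≤ T, ∀ u, |(q r u).form h₁ h₂| ≤ C
  covariance : ∀ A ∈ ring, ∀ s t, s < t → ∀ h,
    ∫⁻ ω, ‖(M t A - M s A) h ω‖ₑ ^ 2 ∂P
      = ∫⁻ r in Ioc s t, ∫⁻ u in A, ENNReal.ofReal ((q r u).val h ^ 2) ∂μ ∂lam

/-! ### Simple integrands and their stochastic integral -/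

namespace CylMartingaleMeasure

variable {Ω : Type*} {mΩ : MeasurableSpace Ω} {P : Measure Ω} {ℱ : Filtration ℝ≥0 mΩ}
  {H : Type*} [NormedAddCommGroup H] [InnerProductSpace ℝ H] [CompleteSpace H]
  {U : Type*} [TopologicalSpace U] [MeasurableSpace U]

/-- The cylindrical random variable `M((s, t], A)`. -/
def incr (M : CylMartingaleMeasure P ℱ H U) (s t : ℝ≥0) (A : Set U) : H →ₗ[ℝ] (Ω →ₘ[P] ℝ) :=
  M.M t A - M.M s A

/-- Families `Φ(r, ω, u)` of bounded operators from `H_{q_{r,u}}` to `G`. -/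
abbrev OpFamily (M : CylMartingaleMeasure P ℱ H U)
    (G : Type*) [NormedAddCommGroup G] [InnerProductSpace ℝ G] : Type _ :=
  ∀ (r : ℝ≥0) (_ω : Ω) (u : U), (M.q r u).Space →L[ℝ] G

/-- The data `(sᵢ, tᵢ, Fᵢ, Aⱼ, Sᵢⱼ)` in a representation of a simple integrand on `[0, T]`. -/
structure SimpleRep (M : CylMartingaleMeasure P ℱ H U) (T : ℝ≥0)
    (G : Type*) [NormedAddCommGroup G] [InnerProductSpace ℝ G] [CompleteSpace G] where
  n : ℕ
  m : ℕ
  s : Fin n → ℝ≥0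
  t : Fin n → ℝ≥0
  F : Fin n → Set Ω
  A : Fin m → Set U
  S : Fin n → Fin m → H →L[ℝ] G
  lt : ∀ i, s i < t i
  le : ∀ i, t i ≤ T
  meas_F : ∀ i, MeasurableSet[ℱ (s i)] (F i)
  mem_A : ∀ j, A j ∈ M.ring
  hs : ∀ i j, IsHilbertSchmidt (S i j)

variable {M : CylMartingaleMeasure P ℱ H U} {T : ℝ≥0}
  {G : Type*} [NormedAddCommGroup G] [InnerProductSpace ℝ G] [CompleteSpace G]

/-- The family `∑ᵢ ∑ⱼ 1_{]sᵢ, tᵢ]}(r) 1_{Fᵢ}(ω) 1_{Aⱼ}(u) Sᵢⱼ ∘ i*_{q_{r,u}}`. It vanishes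
for `r > T`. -/
def SimpleRep.toFamily (R : M.SimpleRep T G) : M.OpFamily G := fun r ω u =>
  ∑ i, ∑ j, ((Ioc (R.s i) (R.t i)).indicator (1 : ℝ≥0 → ℝ) r
    * (R.F i).indicator (1 : Ω → ℝ) ω * (R.A j).indicator (1 : U → ℝ) u) •
      (R.S i j).comp (ContinuousLinearMap.adjoint (M.q r u).incl)

/-- Time intervals that meet coincide, and then the events are disjoint. -/
def SimpleRep.IsSeparated (R : M.SimpleRep T G) : Prop :=
  ∀ k j, k ≠ j → (Ioc (R.s k) (R.t k) ∩ Ioc (R.s j) (R.t j)).Nonempty →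
    Ioc (R.s k) (R.t k) = Ioc (R.s j) (R.t j) ∧ Disjoint (R.F k) (R.F j)

variable (M T G) in
/-- The vector space `S(M, T)` of simple integrands. -/
def simpleIntegrands : Submodule ℝ (M.OpFamily G) where
  carrier := {Φ | ∃ R : M.SimpleRep T G, R.toFamily = Φ}
  zero_mem' := by
    refine ⟨⟨0, 0, Fin.elim0, Fin.elim0, Fin.elim0, Fin.elim0, fun i => i.elim0, fun i => i.elim0,
      fun i => i.elim0, fun i => i.elim0, fun i => i.elim0, fun i => i.elim0⟩, ?_⟩
    funext r ω u
    simp [SimpleRep.toFamily]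
  add_mem' := by
    rintro _ _ ⟨R, rfl⟩ ⟨R', rfl⟩
    refine ⟨⟨R.n + R'.n, R.m + R'.m, Fin.append R.s R'.s, Fin.append R.t R'.t,
      Fin.append R.F R'.F, Fin.append R.A R'.A,
      Fin.append (fun i => Fin.append (R.S i) 0) (fun i => Fin.append 0 (R'.S i)),
      ?_, ?_, ?_, ?_, ?_⟩, ?_⟩
    · intro i
      refine Fin.addCases (fun i => ?_) (fun i => ?_) i
      · simpa using R.lt i
      · simpa using R'.lt i
    · intro i
      refine Fin.addCases (fun i => ?_) (fun i => ?_) i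
      · simpa using R.le i
      · simpa using R'.le i
    · intro i
      refine Fin.addCases (fun i => ?_) (fun i => ?_) i
      · rw [Fin.append_left, Fin.append_left]
        exact R.meas_F i
      · rw [Fin.append_right, Fin.append_right]
        exact R'.meas_F i
    · intro i
      refine Fin.addCases (fun i => ?_) (fun i => ?_) i
      · simpa using R.mem_A i
      · simpa using R'.mem_A i
    · intro i j
      refine Fin.addCases (fun i => ?_) (fun i => ?_) i <;>
      refine Fin.addCases (fun j => ?_) (fun j => ?_) j
      · simpa using R.hs i j
      · simpa using IsHilbertSchmidt.zero
      · simpa using IsHilbertSchmidt.zero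
      · simpa using R'.hs i j
    · funext r ω u
      simp [SimpleRep.toFamily, Fin.sum_univ_add]
  smul_mem' := by
    rintro c _ ⟨R, rfl⟩
    refine ⟨{ R with S := fun i j => c • R.S i j, hs := fun i j => (R.hs i j).smul c }, ?_⟩
    funext r ω u
    simp only [SimpleRep.toFamily, Pi.smul_apply, Finset.smul_sum, ContinuousLinearMap.smul_comp]
    refine Finset.sum_congr rfl fun i _ => Finset.sum_congr rfl fun j _ => ?_
    rw [smul_comm]

/-- `E ∫₀ᵗ ∫_U ‖Φ(r, u)‖² μ(du) λ(dr)` with the Hilbert–Schmidt norm of `L₂(H_{q_{r,u}}, G)`. -/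
def energy (M : CylMartingaleMeasure P ℱ H U) (Φ : M.OpFamily G) (t : ℝ≥0) : ℝ≥0∞ :=
  ∫⁻ ω, ∫⁻ r in Ioc 0 t, ∫⁻ u, hsNormSq (Φ r ω u) ∂M.μ ∂M.lam ∂P

/-- The norm of `Λ²(M, T)`, with values in `[0, ∞]`. -/
def lambdaNorm (M : CylMartingaleMeasure P ℱ H U) (T : ℝ≥0) (Φ : M.OpFamily G) : ℝ≥0∞ :=
  M.energy Φ T ^ (1 / 2 : ℝ)

/-- `Y` is (a version of) the radonified process `Y(s, t, A, S)`: a `G`-valued càdlàg square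
integrable martingale with `⟪Y_r, g⟫ = M((s ∧ r, t ∧ r], A)(S* g)` almost surely. -/
structure IsRadonified (M : CylMartingaleMeasure P ℱ H U) (T s t : ℝ≥0) (A : Set U)
    (S : H →L[ℝ] G) (Y : Iic T → Ω → G) : Prop where
  isMartingale : IsCadlagL2Martingale P ℱ T Y
  version : ∀ (r : Iic T) (g : G),
    (fun ω => ⟪Y r ω, g⟫) =ᵐ[P]
      M.incr (min s r) (min t r) A (ContinuousLinearMap.adjoint S g)

/-- `X` is a stochastic integral process of `Φ`: for some separated representation of `Φ`
and some versions of the radonified processes, `X_t = ∑ᵢ ∑ⱼ 1_{Fᵢ} Y_t(sᵢ, tᵢ, Aⱼ, Sᵢⱼ)`. -/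
def IsSimpleIntegral (M : CylMartingaleMeasure P ℱ H U) (T : ℝ≥0) (Φ : M.OpFamily G)
    (X : Iic T → Ω → G) : Prop :=
  ∃ (R : M.SimpleRep T G) (Y : Fin R.n → Fin R.m → Iic T → Ω → G),
    R.IsSeparated ∧ R.toFamily = Φ ∧
    (∀ i j, M.IsRadonified T (R.s i) (R.t i) (R.A j) (R.S i j) (Y i j)) ∧
    ∀ t ω, X t ω = ∑ i, ∑ j, (R.F i).indicator (Y i j t) ω

end CylMartingaleMeasure

end

/-!
Every representation of a simple integrand, separated or not, satisfies the isometry: polarizing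
the covariance and using the independence of increments gives
`E[1_F M((s, t], A)(h) 1_F' M((s', t'], A')(h')] = P(F ∩ F') ∫∫ q_{r,u}(h, h')`, the integral being
over `(]s, t] ∩ ]s', t']) × (A ∩ A')`, and summing these identities over the terms and over the
coordinates of `G` yields `E‖I_t‖² = E∫∫‖Φ‖²`. Hence the linear relation spanned by the pairs of an
elementary integrand and its integral process relates `0` only to processes indistinguishable from
`0`. It is therefore the graph of a linear map, which Doob's inequality bounds with constant `2`.

For the radonified processes, `∑ₖ E|M(t, A)(S* bₖ)|² < ∞` because `S` is Hilbert–Schmidt, so the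
coordinates `M(t, A)(S* bₖ)` define a `G`-valued square integrable martingale. Its càdlàg version
comes from counting oscillations: the squared moves that a greedy observer of the path records sum
up to at most `E‖X_T‖²` in expectation, so along a countable dense set of times almost every path
has finitely many `ε`-oscillations for every `ε > 0`, hence one-sided limits. As `λ(]s, t]) → 0`
when `t ↓ s`, the martingale is right continuous in probability, and the right limits are a version
of it.
-/

noncomputable section

/-! ### Doob's maximal inequality -/

section SquareIntegrable

variable {Ω : Type*} {mΩ : MeasurableSpace Ω} {P : Measure Ω}

theorem lintegral_enorm_sq_eq_ofReal_integral {G : Type*} [NormedAddCommGroup G] {f : Ω → G}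
    (hf : MemLp f 2 P) : ∫⁻ ω, ‖f ω‖ₑ ^ 2 ∂P = ENNReal.ofReal (∫ ω, ‖f ω‖ ^ 2 ∂P) := by
  rw [ofReal_integral_eq_lintegral_ofReal (hf.integrable_norm_pow two_ne_zero)
    (ae_of_all _ fun _ => by positivity)]
  simp_rw [← ofReal_norm, ENNReal.ofReal_pow (norm_nonneg _)]

theorem integrable_inner_of_memLp {G : Type*} [NormedAddCommGroup G] [InnerProductSpace ℝ G]
    {f g : Ω → G} (hf : MemLp f 2 P) (hg : MemLp g 2 P) : Integrable (fun ω => ⟪f ω, g ω⟫) P := by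
  refine (hf.norm.integrable_mul hg.norm).mono' (hf.1.inner hg.1) (ae_of_all _ fun ω => ?_)
  simpa using norm_inner_le_norm (𝕜 := ℝ) (f ω) (g ω)

end SquareIntegrable

section Doob

theorem partialSups_mul_sub_le (y : ℕ → ℝ) (k : ℕ) :
    partialSups y k * (y (k + 1) - y k)
      ≤ (partialSups y (k + 1) * y (k + 1) - partialSups y (k + 1) ^ 2 / 2)
        - (partialSups y k * y k - partialSups y k ^ 2 / 2) := by
  rw [partialSups_add_one]
  rcases le_total (y (k + 1)) (partialSups y k) with h | h
  · rw [sup_eq_left.2 h]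
    linarith
  · rw [sup_eq_right.2 h]
    nlinarith [sq_nonneg (y (k + 1) - partialSups y k)]

variable {Ω : Type*} {mΩ : MeasurableSpace Ω} {P : Measure Ω}

theorem memLp_partialSups {p : ℝ≥0∞} {Y : ℕ → Ω → ℝ} (hY : ∀ k, MemLp (Y k) p P) (k : ℕ) :
    MemLp (partialSups Y k) p P := by
  induction k with
  | zero => simpa only [partialSups_zero] using hY 0
  | succ k ih => simpa only [partialSups_add_one] using ih.sup (hY (k + 1))

theorem stronglyMeasurable_partialSups {ℱ : Filtration ℕ mΩ} {Y : ℕ → Ω → ℝ}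
    (hY : StronglyAdapted ℱ Y) (k : ℕ) : StronglyMeasurable[ℱ k] (partialSups Y k) := by
  induction k with
  | zero => simpa only [partialSups_zero] using hY 0
  | succ k ih =>
    rw [partialSups_add_one]
    exact continuous_sup.comp_stronglyMeasurable
      ((ih.mono (ℱ.mono k.le_succ)).prodMk (hY (k + 1)))

theorem submartingale_norm_of_martingale {ι G : Type*} [Preorder ι] [NormedAddCommGroup G]
    [NormedSpace ℝ G] [CompleteSpace G] {ℱ : Filtration ι mΩ} {X : ι → Ω → G}
    (hX : Martingale X ℱ P) : Submartingale (fun t ω => ‖X t ω‖) ℱ P := by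
  refine ⟨fun t => (hX.1 t).norm, fun s t hst => ?_, fun t => (hX.integrable t).norm⟩
  filter_upwards [hX.2 s t hst, norm_condExp_le (m := ℱ s) (μ := P) (X t)] with ω hcond hle
  rwa [hcond] at hle

variable [IsFiniteMeasure P]

theorem integral_mul_sub_nonneg_of_submartingale {ι : Type*} [Preorder ι] {ℱ : Filtration ι mΩ}
    {Y : ι → Ω → ℝ} (hY : Submartingale Y ℱ P) (hY2 : ∀ t, MemLp (Y t) 2 P) {s t : ι} (hst : s ≤ t)
    {V : Ω → ℝ} (hV : StronglyMeasurable[ℱ s] V) (hV2 : MemLp V 2 P) (hV0 : 0 ≤ V) :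
    0 ≤ ∫ ω, V ω * (Y t ω - Y s ω) ∂P := by
  have hpull := condExp_mul_of_aestronglyMeasurable_left (m := ℱ s) (g := Y t - Y s)
    hV.aestronglyMeasurable (hV2.integrable_mul ((hY2 t).sub (hY2 s)))
    ((hY.integrable t).sub (hY.integrable s))
  change 0 ≤ ∫ ω, (V * (Y t - Y s)) ω ∂P
  rw [← integral_condExp (ℱ.le s)]
  refine integral_nonneg_of_ae ?_
  filter_upwards [hpull, hY.condExp_sub_nonneg hst] with ω hω hsub
  rw [hω]
  exact mul_nonneg (hV0 ω) hsub

variable {ℱ : Filtration ℕ mΩ}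

theorem integral_partialSups_sq_le_two_mul {Y : ℕ → Ω → ℝ} (hY : Submartingale Y ℱ P)
    (hY2 : ∀ k, MemLp (Y k) 2 P) (hY0 : ∀ k, 0 ≤ Y k) (n : ℕ) :
    ∫ ω, partialSups Y n ω ^ 2 ∂P ≤ 2 * ∫ ω, partialSups Y n ω * Y n ω ∂P := by
  have hS2 := memLp_partialSups hY2
  have hSY : ∀ k l, Integrable (fun ω => partialSups Y k ω * Y l ω) P := fun k l =>
    (hS2 k).integrable_mul (hY2 l)
  have hSS : ∀ k, Integrable (fun ω => partialSups Y k ω ^ 2 / 2) P := fun k =>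
    (hS2 k).integrable_sq.div_const 2
  have hintegrable : ∀ k, Integrable
      (fun ω => partialSups Y k ω * Y k ω - partialSups Y k ω ^ 2 / 2) P :=
    fun k => (hSY k k).sub (hSS k)
  have hD : ∀ k, 0 ≤ ∫ ω, (partialSups Y k ω * Y k ω - partialSups Y k ω ^ 2 / 2) ∂P := by
    intro k
    induction k with
    | zero =>
      refine integral_nonneg fun ω => ?_
      simp only [partialSups_zero, Pi.zero_apply]
      nlinarith [sq_nonneg (Y 0 ω)]
    | succ k ih =>
      have hS0 : 0 ≤ partialSups Y k := (hY0 k).trans (le_partialSups Y k)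
      have hstep : ∫ ω, partialSups Y k ω * (Y (k + 1) ω - Y k ω) ∂P
          ≤ ∫ ω, ((partialSups Y (k + 1) ω * Y (k + 1) ω - partialSups Y (k + 1) ω ^ 2 / 2)
            - (partialSups Y k ω * Y k ω - partialSups Y k ω ^ 2 / 2)) ∂P := by
        refine integral_mono ((hS2 k).integrable_mul ((hY2 (k + 1)).sub (hY2 k)))
          ((hintegrable (k + 1)).sub (hintegrable k)) fun ω => ?_
        simpa only [Pi.partialSups_apply] using partialSups_mul_sub_le (Y · ω) k
      rw [integral_sub (hintegrable (k + 1)) (hintegrable k)] at hstep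
      linarith [integral_mul_sub_nonneg_of_submartingale hY hY2 k.le_succ
        (stronglyMeasurable_partialSups hY.1 k) (hS2 k) hS0]
  have hDn := hD n
  rw [integral_sub (hSY n n) (hSS n), integral_div] at hDn
  linarith

theorem integral_partialSups_sq_le {Y : ℕ → Ω → ℝ} (hY : Submartingale Y ℱ P)
    (hY2 : ∀ k, MemLp (Y k) 2 P) (hY0 : ∀ k, 0 ≤ Y k) (n : ℕ) :
    ∫ ω, partialSups Y n ω ^ 2 ∂P ≤ 4 * ∫ ω, Y n ω ^ 2 ∂P := by
  have hS2 := memLp_partialSups hY2 n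
  have hSS : Integrable (fun ω => partialSups Y n ω ^ 2 / 4) P := hS2.integrable_sq.div_const 4
  have hAMGM : ∫ ω, partialSups Y n ω * Y n ω ∂P
      ≤ ∫ ω, (partialSups Y n ω ^ 2 / 4 + Y n ω ^ 2) ∂P :=
    integral_mono (hS2.integrable_mul (hY2 n)) (hSS.add (hY2 n).integrable_sq) fun ω => by
      nlinarith [sq_nonneg (partialSups Y n ω / 2 - Y n ω)]
  rw [integral_add hSS (hY2 n).integrable_sq, integral_div] at hAMGM
  linarith [integral_partialSups_sq_le_two_mul hY hY2 hY0 n]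

theorem lintegral_iSup_Iic_enorm_sq_le {G : Type*} [NormedAddCommGroup G] [NormedSpace ℝ G]
    [CompleteSpace G] {X : ℕ → Ω → G} (hX : Martingale X ℱ P) (hX2 : ∀ k, MemLp (X k) 2 P)
    (n : ℕ) : ∫⁻ ω, ⨆ k ∈ Iic n, ‖X k ω‖ₑ ^ 2 ∂P ≤ 4 * ∫⁻ ω, ‖X n ω‖ₑ ^ 2 ∂P := by
  have hS2 := memLp_partialSups (fun k => (hX2 k).norm) n
  have hdoob := integral_partialSups_sq_le (submartingale_norm_of_martingale hX)
    (fun k => (hX2 k).norm) (fun k ω => norm_nonneg _) n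
  calc ∫⁻ ω, ⨆ k ∈ Iic n, ‖X k ω‖ₑ ^ 2 ∂P
      ≤ ∫⁻ ω, ‖partialSups (fun k ω => ‖X k ω‖) n ω‖ₑ ^ 2 ∂P := by
        refine lintegral_mono fun ω => iSup₂_le fun k hk => ?_
        have hle : ‖X k ω‖ ≤ partialSups (fun k ω => ‖X k ω‖) n ω :=
          le_partialSups_of_le (fun k ω => ‖X k ω‖) hk ω
        gcongr
        exact enorm_le_iff_norm_le.2 (hle.trans (le_abs_self _))
    _ = ENNReal.ofReal (∫ ω, ‖partialSups (fun k ω => ‖X k ω‖) n ω‖ ^ 2 ∂P) :=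
        lintegral_enorm_sq_eq_ofReal_integral hS2
    _ ≤ ENNReal.ofReal (4 * ∫ ω, ‖X n ω‖ ^ 2 ∂P) := by
        simp only [Real.norm_eq_abs, sq_abs]
        exact ENNReal.ofReal_le_ofReal hdoob
    _ = 4 * ∫⁻ ω, ‖X n ω‖ₑ ^ 2 ∂P := by
        rw [ENNReal.ofReal_mul (by norm_num), ENNReal.ofReal_ofNat,
          lintegral_enorm_sq_eq_ofReal_integral (hX2 n)]

end Doob

/-! ### Counting oscillations -/

section Greedy

variable {E : Type*} [PseudoMetricSpace E]

/-- The reference value of the greedy count of `ε`-oscillations of a sequence `x`: it starts at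
`x 0` and is reset to the current value whenever `x` gets farther than `ε` away from it. -/
def greedyRef (ε : ℝ) (x : ℕ → E) : ℕ → E
  | 0 => x 0
  | k + 1 => if ε < dist (x (k + 1)) (greedyRef ε x k) then x (k + 1) else greedyRef ε x k

/-- The greedy count of `ε`-oscillations of a sequence up to a given index: the number of times
`greedyRef` has been reset. -/
def greedyCount (ε : ℝ) (x : ℕ → E) : ℕ → ℕ
  | 0 => 0
  | k + 1 => greedyCount ε x k + if ε < dist (x (k + 1)) (greedyRef ε x k) then 1 else 0

theorem dist_greedyRef_le {ε : ℝ} (hε : 0 ≤ ε) (x : ℕ → E) (k : ℕ) :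
    dist (x k) (greedyRef ε x k) ≤ ε := by
  cases k with
  | zero => simpa [greedyRef]
  | succ k =>
    rw [greedyRef]
    split_ifs with hfar
    · simpa
    · exact not_lt.1 hfar

theorem monotone_greedyCount (ε : ℝ) (x : ℕ → E) : Monotone (greedyCount ε x) :=
  monotone_nat_of_le_succ fun k => by rw [greedyCount]; exact Nat.le_add_right _ _

theorem greedyCount_le (ε : ℝ) (x : ℕ → E) (k : ℕ) : greedyCount ε x k ≤ k := by
  induction k with
  | zero => exact le_rfl
  | succ k ih => rw [greedyCount]; split_ifs <;> omega

theorem greedyRef_eq_of_greedyCount_eq {ε : ℝ} (x : ℕ → E) {i j : ℕ} (hij : i ≤ j)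
    (hcount : greedyCount ε x j = greedyCount ε x i) : greedyRef ε x j = greedyRef ε x i := by
  induction j, hij using Nat.le_induction with
  | base => rfl
  | succ j hij ih =>
    have hmono := monotone_greedyCount ε x hij
    rw [greedyCount] at hcount
    rw [greedyRef]
    split_ifs at hcount ⊢
    · omega
    · exact ih (by omega)

theorem greedyCount_add_one_le {ε : ℝ} (hε : 0 ≤ ε) (x : ℕ → E) {i j : ℕ} (hij : i ≤ j)
    (hfar : 2 * ε < dist (x i) (x j)) : greedyCount ε x i + 1 ≤ greedyCount ε x j := by
  refine Nat.succ_le_of_lt ((monotone_greedyCount ε x hij).lt_of_ne fun hcount => ?_)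
  have hi := dist_greedyRef_le hε x i
  have hj := dist_greedyRef_le hε x j
  rw [greedyRef_eq_of_greedyCount_eq x hij hcount.symm] at hj
  linarith [dist_triangle_right (x i) (x j) (greedyRef ε x i)]

theorem le_greedyCount_of_monotone {ε : ℝ} (hε : 0 ≤ ε) (x : ℕ → E) {u : ℕ → ℕ} (hu : Monotone u)
    {n : ℕ} (hfar : ∀ i < n, 2 * ε < dist (x (u i)) (x (u (i + 1)))) :
    n ≤ greedyCount ε x (u n) := by
  induction n with
  | zero => exact Nat.zero_le _
  | succ n ih =>
    exact (Nat.add_le_add_right (ih fun i hi => hfar i (hi.trans n.lt_succ_self)) 1).trans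
      (greedyCount_add_one_le hε x (hu n.le_succ) (hfar n n.lt_succ_self))

variable {Ω : Type*} {mΩ : MeasurableSpace Ω} {ℱ : Filtration ℕ mΩ} {X : ℕ → Ω → E}

theorem stronglyMeasurable_greedyRef (hX : StronglyAdapted ℱ X) (ε : ℝ) (k : ℕ) :
    StronglyMeasurable[ℱ k] fun ω => greedyRef ε (X · ω) k := by
  induction k with
  | zero => exact hX 0
  | succ k ih =>
    have ih' := ih.mono (ℱ.mono k.le_succ)
    exact StronglyMeasurable.ite (stronglyMeasurable_const.measurableSet_lt
      ((hX (k + 1)).dist ih')) (hX (k + 1)) ih'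

theorem measurable_greedyCount (hX : StronglyAdapted ℱ X) (ε : ℝ) (k : ℕ) :
    Measurable fun ω => greedyCount ε (X · ω) k := by
  induction k with
  | zero => exact measurable_const
  | succ k ih =>
    exact ih.add (Measurable.ite (stronglyMeasurable_const.measurableSet_lt
      (((hX (k + 1)).mono (ℱ.le _)).dist ((stronglyMeasurable_greedyRef hX ε k).mono (ℱ.le _))))
      measurable_const measurable_const)

theorem integrable_greedyCount {P : Measure Ω} [IsFiniteMeasure P] (hX : StronglyAdapted ℱ X)
    (ε : ℝ) (k : ℕ) : Integrable (fun ω => (greedyCount ε (X · ω) k : ℝ)) P :=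
  Integrable.of_bound (C := k)
    (measurable_from_nat.comp (measurable_greedyCount hX ε k)).aestronglyMeasurable
    (ae_of_all _ fun ω => by simpa using greedyCount_le ε (X · ω) k)

end Greedy

section GreedyNorm

variable {G : Type*} [NormedAddCommGroup G]

theorem greedy_energy_succ_le {ε : ℝ} (hε : 0 ≤ ε) (x : ℕ → G) (k : ℕ) :
    ε ^ 2 * greedyCount ε x (k + 1) + ‖x (k + 1) - greedyRef ε x (k + 1)‖ ^ 2
      ≤ ε ^ 2 * greedyCount ε x k + ‖x (k + 1) - greedyRef ε x k‖ ^ 2 := by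
  rw [greedyCount, greedyRef]
  split_ifs with hfar
  · rw [dist_eq_norm] at hfar
    have hsq : ε ^ 2 ≤ ‖x (k + 1) - greedyRef ε x k‖ ^ 2 := by gcongr
    push_cast
    simp only [sub_self, norm_zero]
    linarith
  · simp

theorem memLp_greedyRef {Ω : Type*} {mΩ : MeasurableSpace Ω} {P : Measure Ω} {ℱ : Filtration ℕ mΩ}
    {X : ℕ → Ω → G} (hX : StronglyAdapted ℱ X) {p : ℝ≥0∞} (hXp : ∀ k, MemLp (X k) p P) (ε : ℝ)
    (k : ℕ) : MemLp (fun ω => greedyRef ε (X · ω) k) p P := by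
  induction k with
  | zero => exact hXp 0
  | succ k ih =>
    refine ((hXp (k + 1)).norm.add ih.norm).mono
      ((stronglyMeasurable_greedyRef hX ε (k + 1)).mono (ℱ.le _)).aestronglyMeasurable
      (ae_of_all _ fun ω => le_trans ?_ (le_abs_self _))
    simp only [greedyRef, Pi.add_apply]
    split_ifs <;> simp

end GreedyNorm

section Orthogonality

variable {Ω : Type*} {mΩ : MeasurableSpace Ω} {P : Measure Ω} [IsFiniteMeasure P]
  {G : Type*} [NormedAddCommGroup G] [InnerProductSpace ℝ G] [CompleteSpace G]

theorem integral_inner_sub_eq_zero {ι : Type*} [Preorder ι] {ℱ : Filtration ι mΩ}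
    {X : ι → Ω → G} (hX : Martingale X ℱ P) (hX2 : ∀ t, MemLp (X t) 2 P) {s t : ι} (hst : s ≤ t)
    {V : Ω → G} (hV : StronglyMeasurable[ℱ s] V) (hV2 : MemLp V 2 P) :
    ∫ ω, ⟪V ω, X t ω - X s ω⟫ ∂P = 0 := by
  have hpull := condExp_bilin_of_stronglyMeasurable_left (m := ℱ s) (g := X t - X s) (innerSL ℝ) hV
    (integrable_inner_of_memLp hV2 ((hX2 t).sub (hX2 s)))
    ((hX.integrable t).sub (hX.integrable s))
  change ∫ ω, innerSL ℝ (V ω) ((X t - X s) ω) ∂P = 0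
  rw [← integral_condExp (ℱ.le s)]
  refine integral_eq_zero_of_ae ?_
  filter_upwards [hpull, condExp_sub (hX.integrable t) (hX.integrable s) (ℱ s),
    hX.condExp_ae_eq hst, hX.condExp_ae_eq (le_refl s)] with ω hω hsub ht hs
  rw [hω, hsub, Pi.sub_apply, ht, hs, sub_self, map_zero, Pi.zero_apply]

theorem integral_norm_sub_sq_eq_add {ι : Type*} [Preorder ι] {ℱ : Filtration ι mΩ}
    {X : ι → Ω → G} (hX : Martingale X ℱ P) (hX2 : ∀ t, MemLp (X t) 2 P) {s t : ι} (hst : s ≤ t)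
    {V : Ω → G} (hV : StronglyMeasurable[ℱ s] V) (hV2 : MemLp V 2 P) :
    ∫ ω, ‖X t ω - V ω‖ ^ 2 ∂P = ∫ ω, ‖X s ω - V ω‖ ^ 2 ∂P + ∫ ω, ‖X t ω - X s ω‖ ^ 2 ∂P := by
  have hXV : MemLp (fun ω => X s ω - V ω) 2 P := (hX2 s).sub hV2
  have hinc : MemLp (fun ω => X t ω - X s ω) 2 P := (hX2 t).sub (hX2 s)
  have hexpand : ∀ ω, ‖X t ω - V ω‖ ^ 2 = (‖X s ω - V ω‖ ^ 2 + ‖X t ω - X s ω‖ ^ 2)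
      + 2 * ⟪X s ω - V ω, X t ω - X s ω⟫ := fun ω => by
    rw [← sub_add_sub_cancel' (X s ω) (V ω) (X t ω), norm_add_sq_real]; ring
  have hXVsq := hXV.integrable_norm_pow two_ne_zero
  have hincsq := hinc.integrable_norm_pow two_ne_zero
  simp_rw [hexpand]
  have hsum : Integrable (fun ω => ‖X s ω - V ω‖ ^ 2 + ‖X t ω - X s ω‖ ^ 2) P := hXVsq.add hincsq
  have horth : ∫ ω, ⟪X s ω - V ω, X t ω - X s ω⟫ ∂P = 0 :=
    integral_inner_sub_eq_zero hX hX2 hst ((hX.stronglyMeasurable s).sub hV) hXV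
  rw [integral_add hsum ((integrable_inner_of_memLp hXV hinc).const_mul 2),
    integral_add hXVsq hincsq, integral_const_mul, horth, mul_zero, add_zero]

variable {ℱ : Filtration ℕ mΩ} {X : ℕ → Ω → G}

theorem integral_greedy_energy_le (hX : Martingale X ℱ P) (hX2 : ∀ k, MemLp (X k) 2 P) {ε : ℝ}
    (hε : 0 ≤ ε) (n : ℕ) :
    ∫ ω, (ε ^ 2 * greedyCount ε (X · ω) n + ‖X n ω - greedyRef ε (X · ω) n‖ ^ 2) ∂P
      ≤ ∫ ω, ‖X n ω‖ ^ 2 ∂P := by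
  induction n with
  | zero =>
    refine integral_mono_of_nonneg (ae_of_all _ fun ω => by positivity)
      ((hX2 0).integrable_norm_pow two_ne_zero) (ae_of_all _ fun ω => ?_)
    simp [greedyCount, greedyRef]
  | succ k ih =>
    have hcount : Integrable (fun ω => ε ^ 2 * (greedyCount ε (X · ω) k : ℝ)) P :=
      (integrable_greedyCount hX.1 ε k).const_mul _
    have href : StronglyMeasurable[ℱ k] fun ω => greedyRef ε (X · ω) k :=
      stronglyMeasurable_greedyRef hX.1 ε k
    have href2 : MemLp (fun ω => greedyRef ε (X · ω) k) 2 P := memLp_greedyRef hX.1 hX2 ε k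
    have hdist : ∀ l, Integrable (fun ω => ‖X l ω - greedyRef ε (X · ω) k‖ ^ 2) P := fun l =>
      ((hX2 l).sub href2).integrable_norm_pow two_ne_zero
    calc ∫ ω, (ε ^ 2 * greedyCount ε (X · ω) (k + 1)
            + ‖X (k + 1) ω - greedyRef ε (X · ω) (k + 1)‖ ^ 2) ∂P
        ≤ ∫ ω, (ε ^ 2 * greedyCount ε (X · ω) k
            + ‖X (k + 1) ω - greedyRef ε (X · ω) k‖ ^ 2) ∂P :=
          integral_mono_of_nonneg (ae_of_all _ fun ω => by positivity)
            (hcount.add (hdist (k + 1))) (ae_of_all _ fun ω => greedy_energy_succ_le hε _ k)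
      _ = ∫ ω, (ε ^ 2 * greedyCount ε (X · ω) k + ‖X k ω - greedyRef ε (X · ω) k‖ ^ 2) ∂P
            + ∫ ω, ‖X (k + 1) ω - X k ω‖ ^ 2 ∂P := by
          rw [integral_add hcount (hdist (k + 1)), integral_add hcount (hdist k),
            integral_norm_sub_sq_eq_add hX hX2 k.le_succ href href2, add_assoc]
      _ ≤ ∫ ω, ‖X k ω‖ ^ 2 ∂P + ∫ ω, ‖X (k + 1) ω - X k ω‖ ^ 2 ∂P := by gcongr
      _ = ∫ ω, ‖X (k + 1) ω‖ ^ 2 ∂P := by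
          simpa using (integral_norm_sub_sq_eq_add hX hX2 k.le_succ (V := 0)
            stronglyMeasurable_const MemLp.zero).symm

theorem lintegral_greedyCount_le (hX : Martingale X ℱ P) (hX2 : ∀ k, MemLp (X k) 2 P) {ε : ℝ}
    (hε : 0 ≤ ε) (n : ℕ) :
    ENNReal.ofReal (ε ^ 2) * ∫⁻ ω, (greedyCount ε (X · ω) n : ℝ≥0∞) ∂P
      ≤ ∫⁻ ω, ‖X n ω‖ₑ ^ 2 ∂P := by
  have hcount : Integrable (fun ω => ε ^ 2 * (greedyCount ε (X · ω) n : ℝ)) P :=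
    (integrable_greedyCount hX.1 ε n).const_mul _
  have hdist : Integrable (fun ω => ‖X n ω - greedyRef ε (X · ω) n‖ ^ 2) P :=
    ((hX2 n).sub (memLp_greedyRef hX.1 hX2 ε n)).integrable_norm_pow two_ne_zero
  calc ENNReal.ofReal (ε ^ 2) * ∫⁻ ω, (greedyCount ε (X · ω) n : ℝ≥0∞) ∂P
      = ENNReal.ofReal (∫ ω, ε ^ 2 * (greedyCount ε (X · ω) n : ℝ) ∂P) := by
        rw [ofReal_integral_eq_lintegral_ofReal hcount (ae_of_all _ fun _ => by positivity),
          ← lintegral_const_mul' _ _ ENNReal.ofReal_ne_top]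
        simp_rw [ENNReal.ofReal_mul (sq_nonneg ε), ENNReal.ofReal_natCast]
    _ ≤ ENNReal.ofReal (∫ ω, ‖X n ω‖ ^ 2 ∂P) := by
        refine ENNReal.ofReal_le_ofReal
          (le_trans (integral_mono hcount (hcount.add hdist) fun ω => ?_)
            (integral_greedy_energy_le hX hX2 hε n))
        exact le_add_of_nonneg_right (by positivity)
    _ = ∫⁻ ω, ‖X n ω‖ₑ ^ 2 ∂P := (lintegral_enorm_sq_eq_ofReal_integral (hX2 n)).symm

end Orthogonality

section JumpCount

variable {ι E : Type*} [LinearOrder ι] [PseudoMetricSpace E]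

/-- The function `f` makes `n` successive moves of size greater than `ε` along an increasing
sequence of points of `D`. -/
def HasJumps (f : ι → E) (ε : ℝ) (D : Set ι) (n : ℕ) : Prop :=
  ∃ u : ℕ → ι, Monotone u ∧ (∀ i, u i ∈ D) ∧ ∀ i < n, ε < dist (f (u i)) (f (u (i + 1)))

/-- The number of `ε`-oscillations of `f` along `D`: the largest number of successive moves of size
greater than `ε`. It plays for regulated functions the part that the variation `eVariationOn` plays
for functions of bounded variation. -/
def jumpCount (f : ι → E) (ε : ℝ) (D : Set ι) : ℕ∞ := ⨆ (n : ℕ) (_ : HasJumps f ε D n), (n : ℕ∞)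

variable {f : ι → E} {ε δ : ℝ} {D D' : Set ι} {n : ℕ}

theorem HasJumps.mono (h : HasJumps f ε D n) (hδ : δ ≤ ε) (hD : D ⊆ D') : HasJumps f δ D' n :=
  let ⟨u, hu, huD, hfar⟩ := h
  ⟨u, hu, fun i => hD (huD i), fun i hi => hδ.trans_lt (hfar i hi)⟩

theorem HasJumps.succ {a b : ι} (h : HasJumps f ε (D ∩ Iic a) n) (ha : a ∈ D) (hb : b ∈ D)
    (hab : a ≤ b) (hfar : 2 * ε < dist (f a) (f b)) : HasJumps f ε (D ∩ Iic b) (n + 1) := by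
  obtain ⟨u, hu, huD, hufar⟩ := h
  obtain ⟨c, hcD, hac, hc⟩ : ∃ c ∈ D ∩ Iic b, a ≤ c ∧ ε < dist (f (u n)) (f c) := by
    by_contra! hclose
    have hca := hclose a ⟨ha, hab⟩ le_rfl
    have hcb := hclose b ⟨hb, le_rfl⟩ hab
    linarith [dist_triangle_left (f a) (f b) (f (u n))]
  refine ⟨fun i => if i ≤ n then u i else c, fun i j hij => ?_, fun i => ?_, fun i hi => ?_⟩
  · dsimp only
    split_ifs with hi hj hj
    · exact hu hij
    · exact (huD i).2.trans hac
    · omega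
    · exact le_rfl
  · dsimp only
    split_ifs
    · exact ⟨(huD i).1, (huD i).2.trans hab⟩
    · exact hcD
  · rcases Nat.lt_succ_iff_lt_or_eq.1 hi with hlt | rfl
    · simpa only [hlt.le, Nat.succ_le_of_lt hlt, if_true] using hufar i hlt
    · simpa using hc

theorem HasJumps.le_jumpCount (h : HasJumps f ε D n) : (n : ℕ∞) ≤ jumpCount f ε D :=
  le_iSup₂_of_le n h le_rfl

theorem jumpCount_mono (hδ : δ ≤ ε) (hD : D ⊆ D') : jumpCount f ε D ≤ jumpCount f δ D' :=
  iSup₂_le fun _ h => (h.mono hδ hD).le_jumpCount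

theorem jumpCount_lt_top_of_frequently_le {α : Type*} {l : Filter α} {N : α → ℕ}
    (hN : ∀ n, HasJumps f ε D n → ∀ᶠ m in l, n ≤ N m) {K : ℕ} (hK : ∃ᶠ m in l, N m ≤ K) :
    jumpCount f ε D < ⊤ := by
  refine lt_of_le_of_lt (iSup₂_le fun n hn => ?_) (ENat.natCast_lt_top K)
  obtain ⟨m, hmK, hnm⟩ := (hK.and_eventually (hN n hn)).exists
  exact_mod_cast hnm.trans hmK

theorem jumpCount_add_one_le {a b : ι} (ha : a ∈ D) (hb : b ∈ D) (hab : a ≤ b)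
    (hfar : 2 * ε < dist (f a) (f b)) :
    jumpCount f ε (D ∩ Iic a) + 1 ≤ jumpCount f ε (D ∩ Iic b) := by
  have hsucc : ∀ n, HasJumps f ε (D ∩ Iic a) n → (n : ℕ∞) + 1 ≤ jumpCount f ε (D ∩ Iic b) :=
    fun n hn => by exact_mod_cast (hn.succ ha hb hab hfar).le_jumpCount
  refine add_le_of_le_tsub_right_of_le ?_
    (iSup₂_le fun n hn => ENat.le_sub_of_add_le_right ENat.one_ne_top (hsucc n hn))
  simpa using hsucc 0 ⟨fun _ => a, monotone_const, fun _ => ⟨ha, le_rfl⟩, by simp⟩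

theorem HasJumps.le_greedyCount (hε : 0 ≤ ε) {s : ℕ → ι} (hs : Monotone s) {N : ℕ}
    (h : HasJumps f (2 * ε) (s '' Iic N) n) : n ≤ greedyCount ε (f ∘ s) N := by
  obtain ⟨u, hu, hus, hfar⟩ := h
  choose v hvN hv using fun i : s '' Iic N => i.2
  let j : ℕ → ℕ := fun i => v ⟨u i, hus i⟩
  have hsj : ∀ i, s (j i) = u i := fun i => hv ⟨u i, hus i⟩
  have hj : Monotone j := fun i i' hii' => by
    rcases (hu hii').eq_or_lt with heq | hlt
    · simp only [j, heq, le_refl]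
    · exact (hs.reflect_lt (by rwa [hsj, hsj])).le
  refine (le_greedyCount_of_monotone hε (f ∘ s) hj fun i hi => ?_).trans
    (monotone_greedyCount ε _ (hvN _))
  simpa only [Function.comp_apply, hsj] using hfar i hi

theorem HasJumps.eventually_image_Iic {d : ℕ → ι} (h : HasJumps f ε (range d) n) :
    ∀ᶠ m in atTop, HasJumps f ε (d '' Iic m) n := by
  obtain ⟨u, hu, hud, hfar⟩ := h
  choose k hk using hud
  have hbound : ∀ᶠ m in atTop, ∀ i ∈ Iic n, k i ≤ m :=
    (eventually_all_finite (finite_Iic n)).2 fun i _ => eventually_ge_atTop (k i)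
  filter_upwards [hbound] with m hm
  refine ⟨fun i => u (min i n), fun i j hij => hu (min_le_min_right n hij),
    fun i => ⟨k (min i n), hm _ (min_le_right i n), hk _⟩, fun i hi => ?_⟩
  simpa only [min_eq_left hi.le, min_eq_left (Nat.succ_le_of_lt hi)] using hfar i hi

theorem eventually_dist_le_of_eventually_jumpCount_eq {l : Filter ι} (hl : D ∈ l)
    (hJ : jumpCount f ε D < ⊤) {c : ℕ}
    (hc : ∀ᶠ a in l, (jumpCount f ε (D ∩ Iic a)).toNat = c) :
    ∀ᶠ p in l ×ˢ l, dist (f p.1) (f p.2) ≤ 2 * ε := by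
  have hfin : ∀ a, jumpCount f ε (D ∩ Iic a) ≠ ⊤ := fun a =>
    ((jumpCount_mono le_rfl inter_subset_left).trans_lt hJ).ne
  have hclose : ∀ a ∈ D, ∀ b ∈ D, a ≤ b → (jumpCount f ε (D ∩ Iic a)).toNat = c →
      (jumpCount f ε (D ∩ Iic b)).toNat = c → dist (f a) (f b) ≤ 2 * ε := by
    intro a ha b hb hab hac hbc
    by_contra! hfar
    have hstep := jumpCount_add_one_le ha hb hab hfar
    rw [← ENat.natCast_toNat (hfin a), ← ENat.natCast_toNat (hfin b), hac, hbc] at hstep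
    exact absurd (by exact_mod_cast hstep : c + 1 ≤ c) (by omega)
  filter_upwards [(hc.and hl).prod_mk (hc.and hl)] with p hp
  obtain ⟨⟨hac, ha⟩, hbc, hb⟩ := hp
  rcases le_total p.1 p.2 with hle | hle
  · exact hclose _ ha _ hb hle hac hbc
  · rw [dist_comm]
    exact hclose _ hb _ ha hle hbc hac

theorem exists_tendsto_of_tendsto_jumpCount [CompleteSpace E] {l : Filter ι} (hl : D ∈ l)
    (hJ : ∀ ε > 0, jumpCount f ε D < ⊤)
    (hc : ∀ ε > 0, ∃ c, Tendsto (fun a => (jumpCount f ε (D ∩ Iic a)).toNat) l (𝓝 c)) [l.NeBot] :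
    ∃ y, Tendsto f l (𝓝 y) := by
  rw [← cauchy_map_iff_exists_tendsto, cauchy_map_iff',
    Metric.uniformity_basis_dist_le.tendsto_right_iff]
  intro ε hε
  obtain ⟨c, hc⟩ := hc (ε / 2) (half_pos hε)
  rw [nhds_discrete, tendsto_pure] at hc
  simpa only [mem_ofPred_eq, mul_div_cancel₀ ε two_ne_zero] using
    eventually_dist_le_of_eventually_jumpCount_eq hl (hJ _ (half_pos hε)) hc

theorem monotone_toNat_jumpCount (hJ : jumpCount f ε D < ⊤) :
    Monotone fun a => (jumpCount f ε (D ∩ Iic a)).toNat := fun _ _ hab =>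
  ENat.toNat_le_toNat (jumpCount_mono le_rfl (inter_subset_inter_right D (Iic_subset_Iic.2 hab)))
    ((jumpCount_mono le_rfl inter_subset_left).trans_lt hJ).ne

variable [TopologicalSpace ι] [OrderTopology ι]

theorem exists_tendsto_nhdsWithin_inter_Ioi [CompleteSpace E] (hJ : ∀ ε > 0, jumpCount f ε D < ⊤)
    (t : ι) : ∃ y, Tendsto f (𝓝[D ∩ Ioi t] t) (𝓝 y) := by
  rcases (𝓝[D ∩ Ioi t] t).eq_or_neBot with hbot | hne
  · exact ⟨f t, hbot ▸ tendsto_bot⟩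
  · refine exists_tendsto_of_tendsto_jumpCount
      (mem_of_superset self_mem_nhdsWithin inter_subset_left) hJ fun ε hε => ⟨_,
        ((monotone_toNat_jumpCount (hJ ε hε)).tendsto_nhdsGT t).mono_left
          (nhdsWithin_mono t inter_subset_right)⟩

theorem exists_tendsto_nhdsWithin_inter_Iio [CompleteSpace E] (hJ : ∀ ε > 0, jumpCount f ε D < ⊤)
    (t : ι) : ∃ y, Tendsto f (𝓝[D ∩ Iio t] t) (𝓝 y) := by
  rcases (𝓝[D ∩ Iio t] t).eq_or_neBot with hbot | hne
  · exact ⟨f t, hbot ▸ tendsto_bot⟩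
  · refine exists_tendsto_of_tendsto_jumpCount
      (mem_of_superset self_mem_nhdsWithin inter_subset_left) hJ fun ε hε => ⟨_,
        ((monotone_toNat_jumpCount (hJ ε hε)).tendsto_nhdsLT t).mono_left
          (nhdsWithin_mono t inter_subset_right)⟩

end JumpCount

section RightLimit

theorem tendsto_nhdsWithin_of_tendsto_limits {X E : Type*} [TopologicalSpace X]
    [TopologicalSpace E] [RegularSpace E] {D I : Set X} (hI : IsOpen I) {f g : X → E} {t : X}
    {y : E} (hf : Tendsto f (𝓝[D ∩ I] t) (𝓝 y)) {l : X → Filter X} (hl : ∀ s, l s ≤ 𝓝[D] s)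
    (hg : ∀ᶠ s in 𝓝[I] t, (l s).NeBot ∧ Tendsto f (l s) (𝓝 (g s))) :
    Tendsto g (𝓝[I] t) (𝓝 y) := by
  refine (closed_nhds_basis y).tendsto_right_iff.2 fun K ⟨hK, hKclosed⟩ => ?_
  have hfK : ∀ᶠ s in 𝓝[I] t, ∀ᶠ s' in 𝓝 s, s' ∈ D ∩ I → f s' ∈ K :=
    nhdsWithin_le_nhds (eventually_eventually_nhds.2 (eventually_nhdsWithin_iff.1 (hf hK)))
  filter_upwards [hg, hfK, self_mem_nhdsWithin] with s ⟨hne, hgs⟩ hs hsI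
  refine hKclosed.mem_of_tendsto hgs ?_
  filter_upwards [hl s self_mem_nhdsWithin, (hl s).trans nhdsWithin_le_nhds hs,
    (hl s).trans nhdsWithin_le_nhds (hI.mem_nhds hsI)] with s' hD hK' hs'I
  exact hK' ⟨hD, hs'I⟩

variable {ι E : Type*} [LinearOrder ι] [OrderTop ι] [TopologicalSpace ι]
  [TopologicalSpace E] [Nonempty E]

/-- The right limit of `f` along `D`; at the last point, which has no right neighbourhood, the value
of `f`. -/
def rightLimOn (D : Set ι) (f : ι → E) (t : ι) : E :=
  open Classical in if t = ⊤ then f ⊤ else limUnder (𝓝[D ∩ Ioi t] t) f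

variable {D : Set ι} {f : ι → E}

theorem rightLimOn_top : rightLimOn D f ⊤ = f ⊤ := if_pos rfl

theorem tendsto_rightLimOn {t : ι} (hf : ∃ y, Tendsto f (𝓝[D ∩ Ioi t] t) (𝓝 y)) :
    Tendsto f (𝓝[D ∩ Ioi t] t) (𝓝 (rightLimOn D f t)) := by
  rcases eq_or_ne t ⊤ with rfl | ht
  · simp
  · rw [rightLimOn, if_neg ht]
    exact tendsto_nhds_limUnder hf

variable [OrderTopology ι] [DenselyOrdered ι]

theorem neBot_nhdsWithin_inter_Ioi (hD : Dense D) {t : ι} (ht : t < ⊤) :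
    (𝓝[D ∩ Ioi t] t).NeBot := by
  rw [← mem_closure_iff_nhdsWithin_neBot, inter_comm]
  refine closure_minimal (hD.open_subset_closure_inter isOpen_Ioi) isClosed_closure ?_
  rw [closure_Ioi' ⟨⊤, ht⟩]
  exact self_mem_Ici

variable [RegularSpace E] (hD : Dense D)
  (hright : ∀ t, ∃ y, Tendsto f (𝓝[D ∩ Ioi t] t) (𝓝 y))

include hD hright

theorem tendsto_rightLimOn_nhdsGT (t : ι) :
    Tendsto (rightLimOn D f) (𝓝[>] t) (𝓝 (rightLimOn D f t)) := by
  rcases eq_or_ne t ⊤ with rfl | ht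
  · simp
  refine tendsto_nhdsWithin_of_tendsto_limits isOpen_Ioi (tendsto_rightLimOn (hright t))
    (l := fun s => 𝓝[D ∩ Ioi s] s) (fun s => nhdsWithin_mono s inter_subset_left) ?_
  filter_upwards [nhdsWithin_le_nhds (Iio_mem_nhds ht.lt_top)] with s hs
  exact ⟨neBot_nhdsWithin_inter_Ioi hD hs, tendsto_rightLimOn (hright s)⟩

theorem exists_tendsto_rightLimOn_nhdsLT (hleft : ∀ t, ∃ y, Tendsto f (𝓝[D ∩ Iio t] t) (𝓝 y))
    (t : ι) : ∃ y, Tendsto (rightLimOn D f) (𝓝[<] t) (𝓝 y) := by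
  obtain ⟨y, hy⟩ := hleft t
  refine ⟨y, tendsto_nhdsWithin_of_tendsto_limits isOpen_Iio hy
    (l := fun s => 𝓝[D ∩ Ioi s] s) (fun s => nhdsWithin_mono s inter_subset_left) ?_⟩
  filter_upwards [self_mem_nhdsWithin] with s hs
  exact ⟨neBot_nhdsWithin_inter_Ioi hD (lt_of_lt_of_le hs le_top), tendsto_rightLimOn (hright s)⟩

end RightLimit

/-! ### Càdlàg modifications of martingales -/

section DenseSequences

variable {ι : Type*} [LinearOrder ι]

theorem exists_monotone_image_Iic_eq {F : Set ι} (hF : F.Finite) (hne : F.Nonempty) :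
    ∃ (s : ℕ → ι) (N : ℕ), Monotone s ∧ s '' Iic N = F := by
  lift F to Finset ι using hF
  have hcard : F.card - 1 < F.card := Nat.sub_one_lt (Finset.card_ne_zero.2 hne)
  let e := F.orderEmbOfFin rfl
  refine ⟨fun k => e ⟨min k (F.card - 1), (min_le_right _ _).trans_lt hcard⟩, F.card - 1,
    fun i j hij => e.monotone (Fin.mk_le_mk.2 (min_le_min_right _ hij)), ?_⟩
  rw [← Finset.range_orderEmbOfFin F rfl]
  refine subset_antisymm (image_subset_iff.2 fun k _ => mem_range_self _) ?_
  rintro _ ⟨i, rfl⟩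
  have hi : (i : ℕ) ≤ F.card - 1 := by omega
  exact ⟨i, hi, by simp only [min_eq_left hi, Fin.eta, e]⟩

variable [OrderTop ι] [TopologicalSpace ι]

theorem exists_denseRange_top_mem [TopologicalSpace.SeparableSpace ι] :
    ∃ d : ℕ → ι, DenseRange d ∧ ⊤ ∈ range d := by
  obtain ⟨D, hD, hdense⟩ := TopologicalSpace.exists_countable_dense ι
  obtain ⟨d, hd⟩ := (hD.insert ⊤).exists_eq_range (insert_nonempty ⊤ D)
  exact ⟨d, by simpa only [DenseRange, ← hd] using hdense.mono (subset_insert ⊤ D),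
    hd ▸ mem_insert ⊤ D⟩

variable [OrderTopology ι] [DenselyOrdered ι]

theorem neBot_nhdsWithin_inter_Ici {D : Set ι} (hD : Dense D) (htop : ⊤ ∈ D) (t : ι) :
    (𝓝[D ∩ Ici t] t).NeBot := by
  rcases eq_or_ne t ⊤ with rfl | ht
  · exact mem_closure_iff_nhdsWithin_neBot.1 (subset_closure ⟨htop, self_mem_Ici⟩)
  · exact (neBot_nhdsWithin_inter_Ioi hD ht.lt_top).mono
      (nhdsWithin_mono t (inter_subset_inter_right D Ioi_subset_Ici_self))

theorem eq_of_eqOn_dense_of_continuousWithinAt_Ici {E : Type*} [TopologicalSpace E] [T2Space E]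
    {D : Set ι} (hD : Dense D) (htop : ⊤ ∈ D) {f g : ι → E}
    (hf : ∀ t, ContinuousWithinAt f (Ici t) t) (hg : ∀ t, ContinuousWithinAt g (Ici t) t)
    (hfg : EqOn f g D) : f = g := by
  ext t
  have := neBot_nhdsWithin_inter_Ici hD htop t
  refine tendsto_nhds_unique_of_eventuallyEq (l := 𝓝[D ∩ Ici t] t)
    ((hf t).mono inter_subset_right) ((hg t).mono inter_subset_right) ?_
  filter_upwards [self_mem_nhdsWithin] with s hs using hfg hs.1

theorem iSup_eq_biSup_dense_of_continuousWithinAt_Ici {D : Set ι} (hD : Dense D) (htop : ⊤ ∈ D)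
    {f : ι → ℝ≥0∞} (hf : ∀ t, ContinuousWithinAt f (Ici t) t) : ⨆ t, f t = ⨆ t ∈ D, f t := by
  refine le_antisymm (iSup_le fun t => ?_) (iSup₂_le fun t _ => le_iSup f t)
  have := neBot_nhdsWithin_inter_Ici hD htop t
  refine le_of_tendsto (x := 𝓝[D ∩ Ici t] t) ((hf t).mono inter_subset_right) ?_
  filter_upwards [self_mem_nhdsWithin] with s hs using le_iSup₂ (f := fun t _ => f t) s hs.1

end DenseSequences

section Sampling

variable {Ω : Type*} {mΩ : MeasurableSpace Ω} {P : Measure Ω} {ι : Type*} [Preorder ι]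
  {ℱ : Filtration ι mΩ}

/-- The discrete filtration obtained by observing `ℱ` along an increasing sequence of times. -/
def sampledFiltration (ℱ : Filtration ι mΩ) {s : ℕ → ι} (hs : Monotone s) : Filtration ℕ mΩ where
  seq k := ℱ (s k)
  mono' _ _ hij := ℱ.mono (hs hij)
  le' k := ℱ.le (s k)

theorem martingale_comp_monotone {G : Type*} [NormedAddCommGroup G] [NormedSpace ℝ G]
    {X : ι → Ω → G} (hX : Martingale X ℱ P) {s : ℕ → ι} (hs : Monotone s) :
    Martingale (fun k => X (s k)) (sampledFiltration ℱ hs) P :=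
  ⟨fun k => hX.1 (s k), fun _ _ hij => hX.2 _ _ (hs hij)⟩

variable [IsFiniteMeasure P] {G : Type*} [NormedAddCommGroup G] [InnerProductSpace ℝ G]
  [CompleteSpace G] {X : ι → Ω → G}

theorem lintegral_enorm_sq_mono_of_martingale (hX : Martingale X ℱ P)
    (hX2 : ∀ t, MemLp (X t) 2 P) {s t : ι} (hst : s ≤ t) :
    ∫⁻ ω, ‖X s ω‖ₑ ^ 2 ∂P ≤ ∫⁻ ω, ‖X t ω‖ₑ ^ 2 ∂P := by
  rw [lintegral_enorm_sq_eq_ofReal_integral (hX2 s), lintegral_enorm_sq_eq_ofReal_integral (hX2 t)]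
  refine ENNReal.ofReal_le_ofReal ?_
  have hpyth := integral_norm_sub_sq_eq_add hX hX2 hst (V := 0) stronglyMeasurable_zero .zero
  simp only [Pi.zero_apply, sub_zero] at hpyth
  rw [hpyth]
  exact le_add_of_nonneg_right (integral_nonneg fun _ => by positivity)

end Sampling

section Regularization

variable {Ω : Type*} {mΩ : MeasurableSpace Ω} {P : Measure Ω}
  {ι : Type*} [LinearOrder ι] [OrderTop ι] {ℱ : Filtration ι mΩ}

section FiniteSamples

variable [IsFiniteMeasure P] {G : Type*} [NormedAddCommGroup G] [InnerProductSpace ℝ G]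
  [CompleteSpace G] {X : ι → Ω → G}

theorem ae_jumpCount_range_lt_top (hX : Martingale X ℱ P) (hX2 : ∀ t, MemLp (X t) 2 P)
    (d : ℕ → ι) {ε : ℝ} (hε : 0 < ε) :
    ∀ᵐ ω ∂P, jumpCount (X · ω) (2 * ε) (range d) < ⊤ := by
  choose s N hs himage using fun m : ℕ =>
    exists_monotone_image_Iic_eq ((finite_Iic m).image d) (nonempty_Iic.image d)
  let c : ℕ → Ω → ℕ := fun m ω => greedyCount ε (fun k => X (s m k) ω) (N m)
  have hc : ∀ m, Measurable fun ω => (c m ω : ℝ≥0∞) := fun m =>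
    measurable_from_nat.comp
      (measurable_greedyCount (martingale_comp_monotone hX (hs m)).1 ε (N m))
  have hbound : ∀ m,
      ∫⁻ ω, c m ω ∂P ≤ (∫⁻ ω, ‖X ⊤ ω‖ₑ ^ 2 ∂P) / ENNReal.ofReal (ε ^ 2) := fun m => by
    rw [ENNReal.le_div_iff_mul_le (Or.inl (by simpa using hε.ne')) (Or.inl (by simp)), mul_comm]
    exact (lintegral_greedyCount_le (martingale_comp_monotone hX (hs m)) (fun k => hX2 _) hε.le
      (N m)).trans (lintegral_enorm_sq_mono_of_martingale hX hX2 le_top)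
  have hfinite : (∫⁻ ω, ‖X ⊤ ω‖ₑ ^ 2 ∂P) / ENNReal.ofReal (ε ^ 2) ≠ ∞ := by
    rw [lintegral_enorm_sq_eq_ofReal_integral (hX2 ⊤)]
    exact ENNReal.div_ne_top ENNReal.ofReal_ne_top (by simpa using hε.ne')
  have hliminf : ∫⁻ ω, liminf (fun m => (c m ω : ℝ≥0∞)) atTop ∂P ≠ ∞ :=
    ne_top_of_le_ne_top hfinite ((lintegral_liminf_le hc).trans
      ((liminf_le_liminf (Eventually.of_forall hbound)).trans (liminf_const _).le))
  filter_upwards [ae_lt_top (Measurable.liminf hc) hliminf] with ω hω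
  obtain ⟨K, hK⟩ := ENNReal.exists_nat_gt hω.ne
  refine jumpCount_lt_top_of_frequently_le (N := (c · ω)) (fun n hn => ?_)
    ((frequently_lt_of_liminf_lt (by isBoundedDefault) hK).mono fun m hm =>
      (by exact_mod_cast hm.le : c m ω ≤ K))
  filter_upwards [hn.eventually_image_Iic] with m hm
  rw [← himage m] at hm
  exact hm.le_greedyCount hε.le (hs m)

theorem ae_forall_jumpCount_range_lt_top (hX : Martingale X ℱ P) (hX2 : ∀ t, MemLp (X t) 2 P)
    (d : ℕ → ι) : ∀ᵐ ω ∂P, ∀ ε > 0, jumpCount (X · ω) ε (range d) < ⊤ := by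
  have hnat : ∀ᵐ ω ∂P, ∀ m : ℕ, jumpCount (X · ω) (2 * (1 / ((m : ℝ) + 1))) (range d) < ⊤ :=
    ae_all_iff.2 fun m => ae_jumpCount_range_lt_top hX hX2 d (by positivity)
  filter_upwards [hnat] with ω hω ε hε
  obtain ⟨m, hm⟩ := exists_nat_one_div_lt (half_pos hε)
  exact (jumpCount_mono (by linarith) Subset.rfl).trans_lt (hω m)

theorem lintegral_biSup_enorm_sq_le (hX : Martingale X ℱ P) (hX2 : ∀ t, MemLp (X t) 2 P)
    {F : Set ι} (hF : F.Finite) :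
    ∫⁻ ω, ⨆ t ∈ F, ‖X t ω‖ₑ ^ 2 ∂P ≤ 4 * ∫⁻ ω, ‖X ⊤ ω‖ₑ ^ 2 ∂P := by
  rcases F.eq_empty_or_nonempty with rfl | hne
  · simp
  obtain ⟨s, N, hs, rfl⟩ := exists_monotone_image_Iic_eq hF hne
  simp only [iSup_image]
  refine (lintegral_iSup_Iic_enorm_sq_le (martingale_comp_monotone hX hs) (fun k => hX2 _) N).trans
    ?_
  gcongr 4 * ?_
  exact lintegral_enorm_sq_mono_of_martingale hX hX2 le_top

end FiniteSamples

theorem stronglyMeasurable_congr_of_null_mem {E : Type*} [TopologicalSpace E]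
    [TopologicalSpace.PseudoMetrizableSpace E] [SecondCountableTopology E] {m : MeasurableSpace Ω}
    (hnull : ∀ N : Set Ω, P N = 0 → MeasurableSet[m] N) {f g : Ω → E}
    (hf : StronglyMeasurable[m] f) (hfg : f =ᵐ[P] g) : StronglyMeasurable[m] g := by
  borelize E
  rw [stronglyMeasurable_iff_measurable] at hf ⊢
  intro B hB
  have hsymm : P (symmDiff (f ⁻¹' B) (g ⁻¹' B)) = 0 :=
    measure_mono_null (fun ω hω => by
      contrapose! hω
      simp only [mem_compl_iff, mem_ofPred_eq, not_not] at hω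
      simp [mem_symmDiff, hω]) hfg
  rw [← symmDiff_symmDiff_cancel_left (f ⁻¹' B) (g ⁻¹' B)]
  exact (hf hB).symmDiff (hnull _ hsymm)

variable [TopologicalSpace ι] [OrderTopology ι] [DenselyOrdered ι]

theorem ae_forall_eq_of_forall_ae_eq [TopologicalSpace.SeparableSpace ι] {E : Type*}
    [TopologicalSpace E] [T2Space E] {X Y : ι → Ω → E}
    (hX : ∀ ω t, ContinuousWithinAt (X · ω) (Ici t) t)
    (hY : ∀ ω t, ContinuousWithinAt (Y · ω) (Ici t) t)
    (hXY : ∀ t, X t =ᵐ[P] Y t) : ∀ᵐ ω ∂P, ∀ t, X t ω = Y t ω := by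
  obtain ⟨d, hd, htop⟩ := exists_denseRange_top_mem (ι := ι)
  filter_upwards [ae_all_iff.2 fun n => hXY (d n)] with ω hω
  exact congr_fun (eq_of_eqOn_dense_of_continuousWithinAt_Ici hd htop (hX ω) (hY ω)
    (forall_mem_range.2 hω))

variable [SecondCountableTopology ι] [IsFiniteMeasure P] {G : Type*} [NormedAddCommGroup G]

theorem ae_eq_rightLimOn {X : ι → Ω → G} (hX : ∀ t, AEStronglyMeasurable (X t) P)
    {D : Set ι} (hD : Dense D) {t : ι} (hrc : TendstoInMeasure P X (𝓝[>] t) (X t))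
    {Y : Ω → G} (hY : ∀ᵐ ω ∂P, Y ω = rightLimOn D (X · ω) t)
    (hlim : ∀ᵐ ω ∂P, ∃ y, Tendsto (X · ω) (𝓝[D ∩ Ioi t] t) (𝓝 y)) :
    Y =ᵐ[P] X t := by
  rcases eq_or_ne t ⊤ with rfl | ht
  · filter_upwards [hY] with ω hω
    rw [hω, rightLimOn_top]
  have := neBot_nhdsWithin_inter_Ioi hD ht.lt_top
  obtain ⟨u, hu⟩ := exists_seq_tendsto (𝓝[D ∩ Ioi t] t)
  refine tendstoInMeasure_ae_unique (tendstoInMeasure_of_tendsto_ae (fun n => hX (u n)) ?_)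
    (hrc.comp (hu.mono_right (nhdsWithin_mono t inter_subset_right)))
  filter_upwards [hY, hlim] with ω hω hlimω
  exact hω ▸ (tendsto_rightLimOn hlimω).comp hu

variable [InnerProductSpace ℝ G] [CompleteSpace G] {X : ι → Ω → G}

theorem exists_cadlag_modification [TopologicalSpace.SeparableSpace G]
    (hnull : ∀ t, ∀ N : Set Ω, P N = 0 → MeasurableSet[ℱ t] N)
    (hX : Martingale X ℱ P) (hX2 : ∀ t, MemLp (X t) 2 P)
    (hrc : ∀ t, TendstoInMeasure P X (𝓝[>] t) (X t)) :
    ∃ Y : ι → Ω → G, Martingale Y ℱ P ∧ (∀ t, MemLp (Y t) 2 P) ∧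
      (∀ ω t, ContinuousWithinAt (Y · ω) (Ici t) t ∧ ∃ y, Tendsto (Y · ω) (𝓝[<] t) (𝓝 y)) ∧
      ∀ t, Y t =ᵐ[P] X t := by
  classical
  have := UniformSpace.secondCountable_of_separable G
  obtain ⟨d, hd, -⟩ := exists_denseRange_top_mem (ι := ι)
  let regular : Set Ω := {ω | ∀ ε > 0, jumpCount (X · ω) ε (range d) < ⊤}
  have hregular : ∀ᵐ ω ∂P, ω ∈ regular := ae_forall_jumpCount_range_lt_top hX hX2 d
  let Y : ι → Ω → G := fun t ω => if ω ∈ regular then rightLimOn (range d) (X · ω) t else 0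
  have hYX : ∀ t, Y t =ᵐ[P] X t := fun t =>
    ae_eq_rightLimOn (fun t => (hX2 t).1) hd (hrc t)
      (hregular.mono fun ω hω => if_pos hω)
      (hregular.mono fun ω hω => exists_tendsto_nhdsWithin_inter_Ioi hω t)
  refine ⟨Y, hX.congr (fun t => stronglyMeasurable_congr_of_null_mem (hnull t)
      (hX.stronglyMeasurable t) (hYX t).symm) fun t => (hYX t).symm,
    fun t => (memLp_congr_ae (hYX t)).2 (hX2 t), fun ω t => ?_, hYX⟩
  by_cases hω : ω ∈ regular
  · have hright := exists_tendsto_nhdsWithin_inter_Ioi hω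
    simp only [Y, if_pos hω]
    exact ⟨continuousWithinAt_Ioi_iff_Ici.1 (tendsto_rightLimOn_nhdsGT hd hright t),
      exists_tendsto_rightLimOn_nhdsLT hd hright (exists_tendsto_nhdsWithin_inter_Iio hω) t⟩
  · simp only [Y, if_neg hω]
    exact ⟨continuousWithinAt_const, 0, tendsto_const_nhds⟩

theorem lintegral_iSup_enorm_sq_le (hX : Martingale X ℱ P) (hX2 : ∀ t, MemLp (X t) 2 P)
    (hrc : ∀ ω t, ContinuousWithinAt (X · ω) (Ici t) t) :
    ∫⁻ ω, ⨆ t, ‖X t ω‖ₑ ^ 2 ∂P ≤ 4 * ∫⁻ ω, ‖X ⊤ ω‖ₑ ^ 2 ∂P := by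
  obtain ⟨d, hd, htop⟩ := exists_denseRange_top_mem (ι := ι)
  have hsup : ∀ ω, ⨆ t, ‖X t ω‖ₑ ^ 2 = ⨆ m, ⨆ t ∈ d '' Iic m, ‖X t ω‖ₑ ^ 2 := fun ω => by
    rw [iSup_eq_biSup_dense_of_continuousWithinAt_Ici hd htop
        fun t => ENNReal.Tendsto.pow (hrc ω t).enorm, ← image_univ, ← iUnion_Iic, image_iUnion,
      iSup_iUnion]
  simp_rw [hsup]
  rw [lintegral_iSup]
  · exact iSup_le fun m =>
      lintegral_biSup_enorm_sq_le hX hX2 ((finite_Iic m).image d)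
  · exact fun m => Measurable.biSup _ ((finite_Iic m).image d).countable fun t _ =>
      ((hX.stronglyMeasurable t).mono (ℱ.le t)).enorm.pow_const 2
  · exact fun m m' hm ω => biSup_mono (image_mono (Iic_subset_Iic.2 hm))

end Regularization

/-! ### Increments of a cylindrical martingale-valued measure -/

theorem integral_mul_eq_add_of_ae_eq_add {Ω : Type*} {mΩ : MeasurableSpace Ω} {P : Measure Ω}
    {f g g₁ g₂ : Ω → ℝ} (hf : MemLp f 2 P) (hg₁ : MemLp g₁ 2 P) (hg₂ : MemLp g₂ 2 P)
    (hg : g =ᵐ[P] g₁ + g₂) :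
    ∫ ω, f ω * g ω ∂P = ∫ ω, f ω * g₁ ω ∂P + ∫ ω, f ω * g₂ ω ∂P := by
  have hintegrable₁ : Integrable (fun ω => f ω * g₁ ω) P := hf.integrable_mul hg₁
  have hintegrable₂ : Integrable (fun ω => f ω * g₂ ω) P := hf.integrable_mul hg₂
  rw [← integral_add hintegrable₁ hintegrable₂]
  refine integral_congr_ae ?_
  filter_upwards [hg] with ω hω
  rw [hω, Pi.add_apply, mul_add]

namespace HilbertianSeminorm

variable {H : Type*} [NormedAddCommGroup H] [InnerProductSpace ℝ H] (q : HilbertianSeminorm H)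

theorem val_sq (h : H) : q.val h ^ 2 = q.form h h := Real.sq_sqrt (q.nonneg h)

theorem form_sum {κ : Type*} (E : Finset κ) (c : κ → ℝ) (h : κ → H) :
    q.form (∑ k ∈ E, c k • h k) (∑ k ∈ E, c k • h k)
      = ∑ k ∈ E, ∑ l ∈ E, c k * c l * q.form (h k) (h l) := by
  rw [LinearMap.map_sum₂]
  refine Finset.sum_congr rfl fun k _ => ?_
  rw [map_sum]
  refine Finset.sum_congr rfl fun l _ => ?_
  rw [LinearMap.map_smul₂, map_smul, smul_eq_mul, smul_eq_mul, mul_assoc]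

end HilbertianSeminorm

namespace CylMartingaleMeasure

variable {Ω : Type*} {mΩ : MeasurableSpace Ω} {P : Measure Ω} {ℱ : Filtration ℝ≥0 mΩ}
  {H : Type*} [NormedAddCommGroup H] [InnerProductSpace ℝ H]
  {U : Type*} [TopologicalSpace U] [MeasurableSpace U]
  (M : CylMartingaleMeasure P ℱ H U)

section TimeSpace

instance : SigmaFinite M.μ := M.sigmaFinite_μ

instance : SigmaFinite M.lam :=
  ⟨⟨⟨fun n : ℕ => Iic (n : ℝ≥0), fun _ => trivial, fun n => M.lam_lt_top n,
    eq_univ_of_forall fun r => mem_iUnion.2 (exists_nat_ge r)⟩⟩⟩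

/-- The product measure `λ ⊗ μ` on time and space. -/
abbrev timeSpace : Measure (ℝ≥0 × U) := M.lam.prod M.μ

variable {A : Set U}

theorem measurableSet_of_mem_ring [BorelSpace U] (hA : A ∈ M.ring) : MeasurableSet A := by
  have hgen : MeasurableSet[MeasurableSpace.generateFrom M.ring] A :=
    MeasurableSpace.measurableSet_generateFrom hA
  rwa [M.generateFrom_ring, ← BorelSpace.measurable_eq (α := U)] at hgen

theorem timeSpace_lt_top (hA : A ∈ M.ring) (T : ℝ≥0) : M.timeSpace (Iic T ×ˢ A) < ∞ := by
  rw [Measure.prod_prod]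
  exact ENNReal.mul_lt_top (M.lam_lt_top T) (M.μ_lt_top A hA)

theorem exists_form_le [CompleteSpace H] (T : ℝ≥0) :
    ∃ C : ℝ, 0 ≤ C ∧ ∀ r ≤ T, ∀ u h, (M.q r u).form h h ≤ C * ‖h‖ ^ 2 := by
  let p : Iic T × U → Seminorm ℝ H := fun i =>
    (normSeminorm ℝ (M.q i.1 i.2).Space).comp (M.q i.1 i.2).incl.toLinearMap
  have hp : ∀ i h, p i h = (M.q i.1 i.2).val h := fun i h => (M.q i.1 i.2).norm_incl h
  have hbdd : BddAbove (range p) := by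
    rw [Seminorm.bddAbove_range_iff]
    intro h
    obtain ⟨C, hC⟩ := M.bounded_q T h h
    refine ⟨√C, forall_mem_range.2 fun i => ?_⟩
    rw [hp]
    exact Real.sqrt_le_sqrt ((le_abs_self _).trans (hC _ i.1.2 _))
  have hcont : Continuous (⨆ i, p i : Seminorm ℝ H) :=
    Seminorm.coe_iSup_eq hbdd ▸
      Seminorm.continuous_iSup p (fun i => (M.q i.1 i.2).incl.continuous.norm) hbdd
  obtain ⟨C, hC, hsup⟩ := Seminorm.bound_of_continuous_normedSpace _ hcont
  refine ⟨C ^ 2, by positivity, fun r hr u h => ?_⟩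
  have hval : (M.q r u).val h ≤ C * ‖h‖ :=
    (hp (⟨r, hr⟩, u) h).symm.trans_le ((le_ciSup hbdd (⟨r, hr⟩, u) h).trans (hsup h))
  rw [← HilbertianSeminorm.val_sq, ← mul_pow]
  exact pow_le_pow_left₀ (Real.sqrt_nonneg _) hval 2

variable [BorelSpace U]

theorem integrableOn_form (hA : A ∈ M.ring) {D : Set (ℝ≥0 × U)} {T : ℝ≥0}
    (hD : D ⊆ Iic T ×ˢ A) (h₁ h₂ : H) :
    IntegrableOn (fun p => (M.q p.1 p.2).form h₁ h₂) D M.timeSpace := by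
  obtain ⟨C, hC⟩ := M.bounded_q T h₁ h₂
  refine IntegrableOn.mono_set (Measure.integrableOn_of_bounded (M := C)
    (M.timeSpace_lt_top hA T).ne (M.measurable_q h₁ h₂).aestronglyMeasurable ?_) hD
  exact (ae_restrict_iff' (measurableSet_Iic.prod (M.measurableSet_of_mem_ring hA))).2
    (ae_of_all _ fun p hp => hC _ hp.1 _)

theorem lintegral_form (hA : A ∈ M.ring) (s t : ℝ≥0) (h : H) :
    ∫⁻ r in Ioc s t, ∫⁻ u in A, ENNReal.ofReal ((M.q r u).val h ^ 2) ∂M.μ ∂M.lam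
      = ENNReal.ofReal (∫ p in Ioc s t ×ˢ A, (M.q p.1 p.2).form h h ∂M.timeSpace) := by
  simp_rw [HilbertianSeminorm.val_sq]
  rw [ofReal_integral_eq_lintegral_ofReal
      (M.integrableOn_form hA (prod_mono Ioc_subset_Iic_self le_rfl) h h)
      (ae_of_all _ fun p => (M.q p.1 p.2).nonneg h), ← Measure.prod_restrict, lintegral_prod]
  exact (M.measurable_q h h).ennreal_ofReal.aemeasurable

end TimeSpace

section Increments

variable {A B : Set U}

theorem coeFn_incr (s t : ℝ≥0) (A : Set U) (h : H) :
    M.incr s t A h =ᵐ[P] fun ω => M.M t A h ω - M.M s A h ω :=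
  AEEqFun.coeFn_sub _ _

theorem coeFn_incr_self (s : ℝ≥0) (A : Set U) (h : H) : M.incr s s A h =ᵐ[P] 0 := by
  filter_upwards [M.coeFn_incr s s A h] with ω hω
  rw [hω, sub_self, Pi.zero_apply]

theorem incr_ae_eq_add_incr (s r t : ℝ≥0) (A : Set U) (h : H) :
    M.incr s t A h =ᵐ[P] M.incr s r A h + M.incr r t A h := by
  filter_upwards [M.coeFn_incr s t A h, M.coeFn_incr s r A h, M.coeFn_incr r t A h]
    with ω hst hsr hrt
  rw [hst, Pi.add_apply, hsr, hrt]
  ring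

theorem incr_map_add (s t : ℝ≥0) (A : Set U) (h₁ h₂ : H) :
    M.incr s t A (h₁ + h₂) =ᵐ[P] M.incr s t A h₁ + M.incr s t A h₂ := by
  rw [map_add]
  exact AEEqFun.coeFn_add _ _

theorem incr_union (hA : A ∈ M.ring) (hB : B ∈ M.ring) (hAB : Disjoint A B) (s t : ℝ≥0) (h : H) :
    M.incr s t (A ∪ B) h =ᵐ[P] M.incr s t A h + M.incr s t B h := by
  have hadd : M.incr s t (A ∪ B) h = M.incr s t A h + M.incr s t B h := by
    simp only [incr, LinearMap.sub_apply, M.union t A hA B hB hAB h, M.union s A hA B hB hAB h]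
    abel
  rw [hadd]
  exact AEEqFun.coeFn_add _ _

theorem memLp_incr (hA : A ∈ M.ring) (s t : ℝ≥0) (h : H) : MemLp (M.incr s t A h) 2 P :=
  (memLp_congr_ae (M.coeFn_incr s t A h)).2 ((M.memLp A hA t h).sub (M.memLp A hA s h))

theorem stronglyMeasurable_incr (hnull : ∀ N : Set Ω, P N = 0 → MeasurableSet[ℱ 0] N)
    (hA : A ∈ M.ring) {s t : ℝ≥0} (hst : s ≤ t) (h : H) :
    StronglyMeasurable[ℱ t] (M.incr s t A h) :=
  stronglyMeasurable_congr_of_null_mem (P := P) (fun N hN => ℱ.mono zero_le _ (hnull N hN))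
    (((M.martingale A hA h).stronglyMeasurable t).sub
      (((M.martingale A hA h).stronglyMeasurable s).mono (ℱ.mono hst)))
    (M.coeFn_incr s t A h).symm

theorem integral_mul_incr_eq_zero [IsFiniteMeasure P] (hA : A ∈ M.ring) {s t : ℝ≥0} (hst : s ≤ t)
    (h : H) {V : Ω → ℝ} (hV : StronglyMeasurable[ℱ s] V) (hV2 : MemLp V 2 P) :
    ∫ ω, V ω * M.incr s t A h ω ∂P = 0 := by
  rw [← integral_inner_sub_eq_zero (M.martingale A hA h) (fun t => M.memLp A hA t h) hst hV hV2]
  refine integral_congr_ae ?_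
  filter_upwards [M.coeFn_incr s t A h] with ω hω
  simp [hω, mul_comm]

theorem setIntegral_incr_mul_incr_eq_zero [IsFiniteMeasure P]
    (hnull : ∀ N : Set Ω, P N = 0 → MeasurableSet[ℱ 0] N) (hA : A ∈ M.ring) (hB : B ∈ M.ring)
    {r s s' t : ℝ≥0} (hrs : r ≤ s) (hss' : s ≤ s') (hst : s' ≤ t) (h₁ h₂ : H) {F : Set Ω}
    (hF : MeasurableSet[ℱ s'] F) :
    ∫ ω in F, M.incr r s A h₁ ω * M.incr s' t B h₂ ω ∂P = 0 := by
  have hF' := ℱ.le s' F hF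
  rw [← M.integral_mul_incr_eq_zero hB hst h₂
    (((M.stronglyMeasurable_incr hnull hA hrs h₁).mono (ℱ.mono hss')).indicator hF)
    ((M.memLp_incr hA r s h₁).indicator hF'), ← integral_indicator hF']
  simp_rw [← indicator_mul_left]

theorem integral_incr_mul_incr_of_disjoint (hA : A ∈ M.ring) (hB : B ∈ M.ring)
    (hAB : Disjoint A B) (s t : ℝ≥0) (h₁ h₂ : H) :
    ∫ ω, M.incr s t A h₁ ω * M.incr s t B h₂ ω ∂P = 0 := by
  have hvalue : ∀ r, ∫ ω, M.M r B h₂ ω * M.incr s t A h₁ ω ∂P = 0 := fun r => by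
    have hadd : M.M t A h₁ =ᵐ[P] M.incr s t A h₁ + M.M s A h₁ := by
      filter_upwards [M.coeFn_incr s t A h₁] with ω hω
      rw [Pi.add_apply, hω, sub_add_cancel]
    have hsplit := integral_mul_eq_add_of_ae_eq_add (M.memLp B hB r h₂) (M.memLp_incr hA s t h₁)
      (M.memLp A hA s h₁) hadd
    rwa [M.orthogonal B hB A hA hAB.symm, M.orthogonal B hB A hA hAB.symm, add_zero,
      eq_comm] at hsplit
  have hadd : M.M t B h₂ =ᵐ[P] M.incr s t B h₂ + M.M s B h₂ := by
    filter_upwards [M.coeFn_incr s t B h₂] with ω hω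
    rw [Pi.add_apply, hω, sub_add_cancel]
  have hsplit := integral_mul_eq_add_of_ae_eq_add (M.memLp_incr hA s t h₁)
    (M.memLp_incr hB s t h₂) (M.memLp B hB s h₂) hadd
  simp_rw [mul_comm (M.incr s t A h₁ _) (M.M _ B h₂ _), hvalue, add_zero] at hsplit
  exact hsplit.symm

end Increments

section Covariance

variable {A B : Set U} [BorelSpace U]

theorem integral_incr_sq (hA : A ∈ M.ring) {s t : ℝ≥0} (hst : s ≤ t) (h : H) :
    ∫ ω, M.incr s t A h ω ^ 2 ∂P
      = ∫ p in Ioc s t ×ˢ A, (M.q p.1 p.2).form h h ∂M.timeSpace := by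
  rcases hst.eq_or_lt with rfl | hst
  · have hzero : (fun ω => M.incr s s A h ω ^ 2) =ᵐ[P] 0 := by
      filter_upwards [M.coeFn_incr_self s A h] with ω hω
      simp [hω]
    simp [integral_congr_ae hzero]
  have hcov := M.covariance A hA s t hst h
  rw [M.lintegral_form hA, ← incr,
    lintegral_enorm_sq_eq_ofReal_integral (M.memLp_incr hA s t h)] at hcov
  simp_rw [Real.norm_eq_abs, sq_abs] at hcov
  exact (ENNReal.ofReal_eq_ofReal_iff (integral_nonneg fun ω => sq_nonneg (M.incr s t A h ω))
    (integral_nonneg fun p : ℝ≥0 × U => (M.q p.1 p.2).nonneg h)).1 hcov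

theorem integral_incr_mul_incr_same (hA : A ∈ M.ring) {s t : ℝ≥0} (hst : s ≤ t) (h₁ h₂ : H) :
    ∫ ω, M.incr s t A h₁ ω * M.incr s t A h₂ ω ∂P
      = ∫ p in Ioc s t ×ˢ A, (M.q p.1 p.2).form h₁ h₂ ∂M.timeSpace := by
  have hadd : ∀ h, ∫ ω, M.incr s t A h ω * M.incr s t A (h₁ + h₂) ω ∂P
      = ∫ ω, M.incr s t A h ω * M.incr s t A h₁ ω ∂P
        + ∫ ω, M.incr s t A h ω * M.incr s t A h₂ ω ∂P := fun h =>
    integral_mul_eq_add_of_ae_eq_add (M.memLp_incr hA s t h) (M.memLp_incr hA s t h₁)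
      (M.memLp_incr hA s t h₂) (M.incr_map_add s t A h₁ h₂)
  have hform : ∀ h, ∫ p in Ioc s t ×ˢ A, (M.q p.1 p.2).form h (h₁ + h₂) ∂M.timeSpace
      = ∫ p in Ioc s t ×ˢ A, (M.q p.1 p.2).form h h₁ ∂M.timeSpace
        + ∫ p in Ioc s t ×ˢ A, (M.q p.1 p.2).form h h₂ ∂M.timeSpace := fun h => by
    have hintegrable := fun h' =>
      M.integrableOn_form hA (T := t) (prod_mono (Ioc_subset_Iic_self (a := s)) le_rfl) h h'
    simp_rw [map_add]
    exact integral_add (hintegrable h₁) (hintegrable h₂)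
  have hsq := M.integral_incr_sq hA hst (h₁ + h₂)
  have hsq₁ := M.integral_incr_sq hA hst h₁
  have hsq₂ := M.integral_incr_sq hA hst h₂
  simp_rw [sq] at hsq hsq₁ hsq₂
  rw [hadd, hform] at hsq
  simp_rw [mul_comm (M.incr s t A (h₁ + h₂) _), (M.q _ _).symm (h₁ + h₂), hadd, hform, hsq₁, hsq₂,
    mul_comm (M.incr s t A h₂ _), (M.q _ _).symm h₂] at hsq
  linarith

theorem integral_incr_mul_incr (hA : A ∈ M.ring) (hB : B ∈ M.ring) {s t : ℝ≥0}
    (hst : s ≤ t) (h₁ h₂ : H) :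
    ∫ ω, M.incr s t A h₁ ω * M.incr s t B h₂ ω ∂P
      = ∫ p in Ioc s t ×ˢ (A ∩ B), (M.q p.1 p.2).form h₁ h₂ ∂M.timeSpace := by
  have hsplit : ∀ {C D : Set U}, C ∈ M.ring → D ∈ M.ring → ∀ h h',
      ∫ ω, M.incr s t C h ω * M.incr s t D h' ω ∂P
        = ∫ ω, M.incr s t C h ω * M.incr s t (D ∩ C) h' ω ∂P := fun {C D} hC hD h h' => by
    have hDC := M.isSetRing.inter_mem hD hC
    have hDC' := M.isSetRing.sdiff_mem hD hC
    have hunion := M.incr_union hDC hDC' disjoint_sdiff_inter.symm s t h'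
    rw [inter_union_sdiff] at hunion
    rw [integral_mul_eq_add_of_ae_eq_add (M.memLp_incr hC s t h) (M.memLp_incr hDC s t h')
      (M.memLp_incr hDC' s t h') hunion,
      M.integral_incr_mul_incr_of_disjoint hC hDC' disjoint_sdiff_right, add_zero]
  have hBA := M.isSetRing.inter_mem hB hA
  rw [hsplit hA hB]
  simp_rw [mul_comm (M.incr s t A h₁ _)]
  rw [hsplit hBA hA, ← inter_assoc, inter_comm A B, inter_eq_left.2 (inter_subset_right (s := B)),
    M.integral_incr_mul_incr_same hBA hst]
  simp_rw [(M.q _ _).symm h₂]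

theorem setIntegral_incr_mul_incr (hA : A ∈ M.ring) (hB : B ∈ M.ring) {s t : ℝ≥0}
    (hst : s ≤ t) (h₁ h₂ : H) {F : Set Ω} (hF : MeasurableSet[ℱ s] F) :
    ∫ ω in F, M.incr s t A h₁ ω * M.incr s t B h₂ ω ∂P
      = P.real F * ∫ p in Ioc s t ×ˢ (A ∩ B), (M.q p.1 p.2).form h₁ h₂ ∂M.timeSpace := by
  rcases hst.eq_or_lt with rfl | hlt
  · have hzero : (fun ω => M.incr s s A h₁ ω * M.incr s s B h₂ ω) =ᵐ[P.restrict F] 0 := by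
      filter_upwards [ae_restrict_of_ae (M.coeFn_incr_self s A h₁)] with ω hω
      simp [hω]
    simp [integral_congr_ae hzero]
  rw [← M.integral_incr_mul_incr hA hB hst]
  exact Indep.setIntegral_eq_mul (f := fun x : ℝ × ℝ => x.1 * x.2) (ℱ.le s)
    (M.indep s t hlt A hA B hB h₁ h₂).symm
    ((M.memLp_incr hA s t h₁).1.aemeasurable.prodMk (M.memLp_incr hB s t h₂).1.aemeasurable) hF
    (by fun_prop)

variable [IsFiniteMeasure P] (hnull : ∀ N : Set Ω, P N = 0 → MeasurableSet[ℱ 0] N)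
include hnull

theorem setIntegral_incr_mul_incr_min (hA : A ∈ M.ring) (hB : B ∈ M.ring) {s t t' : ℝ≥0}
    (hst : s ≤ t) (hst' : s ≤ t') (h₁ h₂ : H) {F : Set Ω} (hF : MeasurableSet[ℱ s] F) :
    ∫ ω in F, M.incr s t A h₁ ω * M.incr s t' B h₂ ω ∂P
      = P.real F * ∫ p in Ioc s (min t t') ×ˢ (A ∩ B),
        (M.q p.1 p.2).form h₁ h₂ ∂M.timeSpace := by
  wlog htt : t ≤ t' generalizing t t' A B h₁ h₂
  · have hswap := this hB hA hst' hst h₂ h₁ (le_of_not_ge htt)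
    simp_rw [mul_comm (M.incr s t' B h₂ _), inter_comm B, min_comm t',
      (M.q _ _).symm h₂] at hswap
    exact hswap
  rw [min_eq_left htt, integral_mul_eq_add_of_ae_eq_add ((M.memLp_incr hA s t h₁).restrict F)
      ((M.memLp_incr hB s t h₂).restrict F) ((M.memLp_incr hB t t' h₂).restrict F)
      (ae_restrict_of_ae (M.incr_ae_eq_add_incr s t t' B h₂)),
    M.setIntegral_incr_mul_incr hA hB hst h₁ h₂ hF,
    M.setIntegral_incr_mul_incr_eq_zero hnull hA hB hst le_rfl htt h₁ h₂ (ℱ.mono hst F hF),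
    add_zero]

theorem setIntegral_incr_mul_incr_of_le (hA : A ∈ M.ring) (hB : B ∈ M.ring) {s t s' t' : ℝ≥0}
    (hst : s ≤ t) (hst' : s' ≤ t') (hss' : s ≤ s') (h₁ h₂ : H) {F : Set Ω}
    (hF : MeasurableSet[ℱ s'] F) :
    ∫ ω in F, M.incr s t A h₁ ω * M.incr s' t' B h₂ ω ∂P
      = P.real F * ∫ p in (Ioc s t ∩ Ioc s' t') ×ˢ (A ∩ B),
        (M.q p.1 p.2).form h₁ h₂ ∂M.timeSpace := by
  rcases le_total t s' with hts | hts
  · rw [M.setIntegral_incr_mul_incr_eq_zero hnull hA hB hst hts hst' h₁ h₂ hF,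
      (Ioc_disjoint_Ioc_of_le hts).inter_eq]
    simp
  · have hsplit := integral_mul_eq_add_of_ae_eq_add ((M.memLp_incr hB s' t' h₂).restrict F)
      ((M.memLp_incr hA s s' h₁).restrict F) ((M.memLp_incr hA s' t h₁).restrict F)
      (ae_restrict_of_ae (M.incr_ae_eq_add_incr s s' t A h₁))
    simp_rw [mul_comm (M.incr s' t' B h₂ _)] at hsplit
    rw [hsplit, M.setIntegral_incr_mul_incr_eq_zero hnull hA hB hss' le_rfl hst' h₁ h₂ hF,
      zero_add, M.setIntegral_incr_mul_incr_min hnull hA hB hts hst' h₁ h₂ hF, Ioc_inter_Ioc,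
      sup_eq_right.2 hss']

theorem integral_indicator_incr_mul_indicator_incr (hA : A ∈ M.ring) (hB : B ∈ M.ring)
    {s t s' t' : ℝ≥0} (hst : s ≤ t) (hst' : s' ≤ t') (h₁ h₂ : H) {F F' : Set Ω}
    (hF : MeasurableSet[ℱ s] F) (hF' : MeasurableSet[ℱ s'] F') :
    ∫ ω, F.indicator (M.incr s t A h₁) ω * F'.indicator (M.incr s' t' B h₂) ω ∂P
      = P.real (F ∩ F') * ∫ p in (Ioc s t ∩ Ioc s' t') ×ˢ (A ∩ B),
        (M.q p.1 p.2).form h₁ h₂ ∂M.timeSpace := by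
  simp_rw [← inter_indicator_mul]
  rw [integral_indicator ((ℱ.le s F hF).inter (ℱ.le s' F' hF'))]
  rcases le_total s s' with hss' | hss'
  · exact M.setIntegral_incr_mul_incr_of_le hnull hA hB hst hst' hss' h₁ h₂
      ((ℱ.mono hss' F hF).inter hF')
  · simp_rw [mul_comm (M.incr s t A h₁ _), inter_comm (Ioc s t), inter_comm A,
      (M.q _ _).symm h₁]
    exact M.setIntegral_incr_mul_incr_of_le hnull hB hA hst' hst hss' h₂ h₁
      (hF.inter (ℱ.mono hss' F' hF'))

end Covariance

end CylMartingaleMeasure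

/-! ### Radonification -/

section Coordinates

variable {G : Type*} [NormedAddCommGroup G] [InnerProductSpace ℝ G] {ι : Type*}

theorem countable_of_orthonormal [TopologicalSpace.SeparableSpace G] {v : ι → G}
    (hv : Orthonormal ℝ v) : Countable ι := by
  refine Pairwise.countable_of_isOpen_disjoint (s := fun i => Metric.ball (v i) (1 / 2))
    (fun i j hij => Metric.ball_disjoint_ball ?_) (fun i => Metric.isOpen_ball)
    fun i => ⟨v i, Metric.mem_ball_self (by norm_num)⟩
  have hdist : ‖v i - v j‖ ^ 2 = 2 := by
    rw [norm_sub_sq_real, hv.1 i, hv.1 j, hv.2 hij]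
    norm_num
  rw [dist_eq_norm]
  nlinarith [norm_nonneg (v i - v j)]

theorem hsNormSq_eq_tsum_adjoint {E : Type*} [NormedAddCommGroup E] [InnerProductSpace ℝ E]
    [CompleteSpace E] [CompleteSpace G] (b : HilbertBasis ι ℝ G) (S : E →L[ℝ] G) :
    hsNormSq S = ∑' k, ‖ContinuousLinearMap.adjoint S (b k)‖ₑ ^ 2 := by
  obtain ⟨w, c, -⟩ := exists_hilbertBasis ℝ E
  rw [hsNormSq_eq_tsum c, tsum_enorm_sq_eq_adjoint c b]

theorem exists_hasSum_smul_of_tsum_enorm_sq_ne_top (b : HilbertBasis ι ℝ G) {c : ι → ℝ}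
    (hc : ∑' k, ‖c k‖ₑ ^ 2 ≠ ∞) : ∃ x, HasSum (fun k => c k • b k) x ∧ ∀ k, ⟪x, b k⟫ = c k := by
  have hsum : Summable fun k => ‖c k‖ ^ 2 := by simpa using ENNReal.summable_toReal hc
  have hmem : Memℓp c 2 := memℓp_gen (by simpa using hsum)
  refine ⟨_, b.hasSum_repr_symm ⟨c, hmem⟩, fun k => ?_⟩
  rw [real_inner_comm, ← b.repr_apply_apply, LinearIsometryEquiv.apply_symm_apply]

variable {Ω : Type*} {m mΩ : MeasurableSpace Ω} {P : Measure Ω}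

theorem ae_eq_of_forall_inner [TopologicalSpace.SeparableSpace G] {X Y : Ω → G}
    (h : ∀ g, (fun ω => ⟪X ω, g⟫) =ᵐ[P] fun ω => ⟪Y ω, g⟫) : X =ᵐ[P] Y := by
  have := UniformSpace.secondCountable_of_separable G
  refine (ae_eq_zero_of_forall_inner (𝕜 := ℝ) fun g => ?_).mono fun ω => sub_eq_zero.1
  filter_upwards [h g] with ω hω
  rw [inner_sub_right, real_inner_comm, hω, real_inner_comm, sub_self, Pi.zero_apply]

theorem exists_stronglyMeasurable_inner_basis_eq [CompleteSpace G] [Countable ι]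
    (b : HilbertBasis ι ℝ G) {c : ι → Ω → ℝ} (hc : ∀ k, StronglyMeasurable (c k)) :
    ∃ Z : Ω → G, StronglyMeasurable Z ∧
      ∀ ω, ∑' k, ‖c k ω‖ₑ ^ 2 ≠ ∞ → ∀ k, ⟪Z ω, b k⟫ = c k ω := by
  have hpartial : ∀ E : Finset ι, StronglyMeasurable fun ω => ∑ k ∈ E, c k ω • b k := fun E =>
    Finset.stronglyMeasurable_fun_sum E fun k _ => (hc k).smul_const (b k)
  refine ⟨_, StronglyMeasurable.limUnder (l := atTop) hpartial, fun ω hω k => ?_⟩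
  obtain ⟨x, hx, hxb⟩ := exists_hasSum_smul_of_tsum_enorm_sq_ne_top b hω
  have hlim : Tendsto (fun E : Finset ι => ∑ k ∈ E, c k ω • b k) atTop (𝓝 x) := hx
  rw [hlim.limUnder_eq, hxb]

theorem inner_ae_eq_of_forall_basis (b : HilbertBasis ι ℝ G) (L : G →ₗ[ℝ] Ω →ₘ[P] ℝ)
    (hL : ∀ g₀, TendstoInMeasure P (fun g => ⇑(L g)) (𝓝 g₀) (L g₀)) {Z : Ω → G}
    (hZ : ∀ k, (fun ω => ⟪Z ω, b k⟫) =ᵐ[P] L (b k)) (g : G) :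
    (fun ω => ⟪Z ω, g⟫) =ᵐ[P] L g := by
  have hspan : ∀ x ∈ Submodule.span ℝ (range b), (fun ω => ⟪Z ω, x⟫) =ᵐ[P] L x := fun x hx => by
    induction hx using Submodule.span_induction with
    | mem x hx =>
      obtain ⟨k, rfl⟩ := hx
      exact hZ k
    | zero =>
      simp only [map_zero, inner_zero_right]
      exact AEEqFun.coeFn_zero.symm
    | add x y _ _ hx hy =>
      simp only [map_add, inner_add_right]
      exact (hx.add hy).trans (AEEqFun.coeFn_add _ _).symm
    | smul a x _ hx =>
      simp only [map_smul, inner_smul_right]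
      exact (hx.const_smul a).trans (AEEqFun.coeFn_smul _ _).symm
  have hg : g ∈ closure (Submodule.span ℝ (range b) : Set G) := by
    rw [← Submodule.topologicalClosure_coe, b.dense_span]
    trivial
  obtain ⟨x, hx, hxg⟩ := mem_closure_iff_seq_limit.1 hg
  obtain ⟨ns, hns, hlim⟩ := ((hL g).comp hxg).exists_seq_tendsto_ae'
  filter_upwards [hlim, ae_all_iff.2 fun n => hspan (x n) (hx n)] with ω hω hxω
  refine tendsto_nhds_unique ?_ hω
  simp_rw [Function.comp_apply, ← hxω]
  exact tendsto_const_nhds.inner (hxg.comp hns)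

theorem exists_stronglyMeasurable_inner_ae_eq [CompleteSpace G] [Countable ι] (hm : m ≤ mΩ)
    (b : HilbertBasis ι ℝ G) (L : G →ₗ[ℝ] Ω →ₘ[P] ℝ)
    (hL : ∀ g₀, TendstoInMeasure P (fun g => ⇑(L g)) (𝓝 g₀) (L g₀))
    (hLm : ∀ g, StronglyMeasurable[m] (L g))
    (hsum : ∑' k, ∫⁻ ω, ‖L (b k) ω‖ₑ ^ 2 ∂P ≠ ∞) :
    ∃ Z : Ω → G, StronglyMeasurable[m] Z ∧ ∀ g, (fun ω => ⟪Z ω, g⟫) =ᵐ[P] L g := by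
  have hmeas : ∀ k, AEMeasurable (fun ω => ‖L (b k) ω‖ₑ ^ 2) P := fun k =>
    ((hLm (b k)).mono hm).aestronglyMeasurable.enorm.pow_const 2
  rw [← lintegral_tsum hmeas] at hsum
  obtain ⟨Z, hZm, hZ⟩ := exists_stronglyMeasurable_inner_basis_eq b fun k => hLm (b k)
  refine ⟨Z, hZm, inner_ae_eq_of_forall_basis b L hL fun k => ?_⟩
  filter_upwards [ae_lt_top' (AEMeasurable.tsum hmeas) hsum] with ω hω
  exact hZ ω hω.ne k

theorem lintegral_enorm_sq_eq_tsum_of_inner_ae_eq [Countable ι] (b : HilbertBasis ι ℝ G)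
    {Z : Ω → G} {c : ι → Ω → ℝ} (hc : ∀ k, AEStronglyMeasurable (c k) P)
    (hZ : ∀ k, (fun ω => ⟪Z ω, b k⟫) =ᵐ[P] c k) :
    ∫⁻ ω, ‖Z ω‖ₑ ^ 2 ∂P = ∑' k, ∫⁻ ω, ‖c k ω‖ₑ ^ 2 ∂P := by
  rw [← lintegral_tsum fun k => (hc k).enorm.pow_const 2]
  refine lintegral_congr_ae ?_
  filter_upwards [ae_all_iff.2 hZ] with ω hω
  simp_rw [enorm_sq_eq_tsum_inner b, hω]

theorem martingale_of_forall_inner [CompleteSpace G] [IsFiniteMeasure P] [Preorder ι]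
    {ℱ : Filtration ι mΩ} {X : ι → Ω → G} (hm : ∀ t, StronglyMeasurable[ℱ t] (X t))
    (hi : ∀ t, Integrable (X t) P) {N : G → ι → Ω → ℝ} (hN : ∀ g, Martingale (N g) ℱ P)
    (hXN : ∀ t g, (fun ω => ⟪X t ω, g⟫) =ᵐ[P] N g t) : Martingale X ℱ P := by
  refine ⟨hm, fun i j hij => ?_⟩
  refine (ae_eq_condExp_of_forall_setIntegral_eq (ℱ.le i) (hi j)
    (fun _ _ _ => (hi i).integrableOn) (fun B hB _ => ?_) (hm i).aestronglyMeasurable).symm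
  refine ext_inner_left ℝ fun g => ?_
  have hinner : ∀ t, ∫ ω in B, ⟪g, X t ω⟫ ∂P = ∫ ω in B, N g t ω ∂P := fun t =>
    integral_congr_ae (ae_restrict_of_ae ((hXN t g).mono fun ω hω =>
      (real_inner_comm _ _).trans hω))
  rw [← integral_inner (hi i).integrableOn, ← integral_inner (hi j).integrableOn, hinner, hinner]
  exact (hN g).setIntegral_eq hij hB

theorem tendstoInMeasure_of_tendsto_lintegral_enorm_sq {E : Type*} [NormedAddCommGroup E]
    {l : Filter ι} {X : ι → Ω → E} {Y : Ω → E} (hX : ∀ i, AEStronglyMeasurable (X i) P)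
    (hY : AEStronglyMeasurable Y P)
    (hXY : Tendsto (fun i => ∫⁻ ω, ‖X i ω - Y ω‖ₑ ^ 2 ∂P) l (𝓝 0)) : TendstoInMeasure P X l Y := by
  refine tendstoInMeasure_of_tendsto_eLpNorm (p := 2) two_ne_zero hX hY ?_
  have hlim := hXY.ennrpow_const (1 / 2 : ℝ)
  rw [ENNReal.zero_rpow_of_pos (by norm_num)] at hlim
  simpa [eLpNorm_eq_lintegral_rpow_enorm_toReal two_ne_zero ENNReal.ofNat_ne_top] using hlim

end Coordinates

namespace CylMartingaleMeasure

variable {Ω : Type*} {mΩ : MeasurableSpace Ω} {P : Measure Ω}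
  {ℱ : Filtration ℝ≥0 mΩ}
  {H : Type*} [NormedAddCommGroup H] [InnerProductSpace ℝ H]
  {U : Type*} [TopologicalSpace U] [MeasurableSpace U]
  (M : CylMartingaleMeasure P ℱ H U) {A : Set U}

theorem incr_zero_left (hA : A ∈ M.ring) (t : ℝ≥0) (h : H) : M.incr 0 t A h = M.M t A h := by
  simp [incr, M.zero_time A hA]

theorem lintegral_enorm_incr_sq_le (hA : A ∈ M.ring) {T : ℝ≥0} {C : ℝ}
    (hC : ∀ r ≤ T, ∀ u h, (M.q r u).form h h ≤ C * ‖h‖ ^ 2) {s t : ℝ≥0} (hst : s ≤ t) (ht : t ≤ T)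
    (h : H) :
    ∫⁻ ω, ‖M.incr s t A h ω‖ₑ ^ 2 ∂P
      ≤ ENNReal.ofReal C * M.μ A * M.lam (Ioc s t) * ‖h‖ₑ ^ 2 := by
  rcases hst.eq_or_lt with rfl | hlt
  · have hzero : (fun ω => ‖M.incr s s A h ω‖ₑ ^ 2) =ᵐ[P] 0 := by
      filter_upwards [M.coeFn_incr_self s A h] with ω hω
      simp [hω]
    simp [lintegral_congr_ae hzero]
  rw [incr, M.covariance A hA s t hlt]
  calc ∫⁻ r in Ioc s t, ∫⁻ u in A, ENNReal.ofReal ((M.q r u).val h ^ 2) ∂M.μ ∂M.lam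
      ≤ ∫⁻ _ in Ioc s t, ∫⁻ _ in A, ENNReal.ofReal C * ‖h‖ₑ ^ 2 ∂M.μ ∂M.lam := by
        refine setLIntegral_mono' measurableSet_Ioc fun r hr => lintegral_mono fun u => ?_
        rw [HilbertianSeminorm.val_sq, ← ofReal_norm h, ← ENNReal.ofReal_pow (norm_nonneg _),
          ← ENNReal.ofReal_mul' (by positivity)]
        exact ENNReal.ofReal_le_ofReal (hC r (hr.2.trans ht) u h)
    _ = ENNReal.ofReal C * M.μ A * M.lam (Ioc s t) * ‖h‖ₑ ^ 2 := by
        simp only [lintegral_const, Measure.restrict_apply_univ]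
        ring

theorem tendsto_lam_Ioc (s : ℝ≥0) : Tendsto (fun t => M.lam (Ioc s t)) (𝓝[>] s) (𝓝 0) := by
  have hlim := tendsto_measure_biInter_gt (μ := M.lam) (s := Ioc s) (a := s)
    (fun _ _ => measurableSet_Ioc.nullMeasurableSet) (fun _ _ _ => Ioc_subset_Ioc_right)
    ⟨s + 1, lt_add_one s, ((measure_mono Ioc_subset_Iic_self).trans_lt (M.lam_lt_top _)).ne⟩
  have hinter : ⋂ t > s, Ioc s t = ∅ := eq_empty_of_forall_notMem fun x hx => by
    have hsx : s < x := (mem_iInter₂.1 hx (s + 1) (lt_add_one s)).1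
    obtain ⟨t, hst, htx⟩ := exists_between hsx
    exact htx.not_ge (mem_iInter₂.1 hx t hst).2
  rwa [hinter, measure_empty] at hlim

variable [CompleteSpace H]
  {G : Type*} [NormedAddCommGroup G] [InnerProductSpace ℝ G] [CompleteSpace G]
  {S : H →L[ℝ] G}

theorem tsum_lintegral_enorm_incr_adjoint_sq_le {ι : Type*} (b : HilbertBasis ι ℝ G)
    (hA : A ∈ M.ring) {T : ℝ≥0} {C : ℝ} (hC : ∀ r ≤ T, ∀ u h, (M.q r u).form h h ≤ C * ‖h‖ ^ 2)
    {s t : ℝ≥0} (hst : s ≤ t) (ht : t ≤ T) :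
    ∑' k, ∫⁻ ω, ‖M.incr s t A (ContinuousLinearMap.adjoint S (b k)) ω‖ₑ ^ 2 ∂P
      ≤ ENNReal.ofReal C * M.μ A * M.lam (Ioc s t) * hsNormSq S := by
  rw [hsNormSq_eq_tsum_adjoint b, ← ENNReal.tsum_mul_left]
  exact ENNReal.tsum_le_tsum fun k => M.lintegral_enorm_incr_sq_le hA hC hst ht _

variable [TopologicalSpace.SeparableSpace G]

theorem lintegral_enorm_sq_le_of_inner_ae_eq_incr (hA : A ∈ M.ring) {T : ℝ≥0} {C : ℝ}
    (hC : ∀ r ≤ T, ∀ u h, (M.q r u).form h h ≤ C * ‖h‖ ^ 2) {s t : ℝ≥0} (hst : s ≤ t) (ht : t ≤ T)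
    {Z : Ω → G}
    (hZ : ∀ g, (fun ω => ⟪Z ω, g⟫) =ᵐ[P] M.incr s t A (ContinuousLinearMap.adjoint S g)) :
    ∫⁻ ω, ‖Z ω‖ₑ ^ 2 ∂P ≤ ENNReal.ofReal C * M.μ A * M.lam (Ioc s t) * hsNormSq S := by
  obtain ⟨w, b, -⟩ := exists_hilbertBasis ℝ G
  have := countable_of_orthonormal b.orthonormal
  rw [lintegral_enorm_sq_eq_tsum_of_inner_ae_eq b (fun k => (M.memLp_incr hA s t _).1)
    fun k => hZ (b k)]
  exact M.tsum_lintegral_enorm_incr_adjoint_sq_le b hA hC hst ht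

theorem exists_stronglyMeasurable_inner_ae_eq_M_adjoint (hA : A ∈ M.ring) (hS : IsHilbertSchmidt S)
    (t : ℝ≥0) :
    ∃ Z : Ω → G, StronglyMeasurable[ℱ t] Z ∧ MemLp Z 2 P ∧
      ∀ g, (fun ω => ⟪Z ω, g⟫) =ᵐ[P] M.M t A (ContinuousLinearMap.adjoint S g) := by
  obtain ⟨w, b, -⟩ := exists_hilbertBasis ℝ G
  have := countable_of_orthonormal b.orthonormal
  obtain ⟨C, -, hC⟩ := M.exists_form_le t
  have hfinite : ENNReal.ofReal C * M.μ A * M.lam (Ioc 0 t) * hsNormSq S < ∞ :=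
    ENNReal.mul_lt_top (ENNReal.mul_lt_top (ENNReal.mul_lt_top ENNReal.ofReal_lt_top
      (M.μ_lt_top A hA)) ((measure_mono Ioc_subset_Iic_self).trans_lt (M.lam_lt_top t))) hS
  have hsum := M.tsum_lintegral_enorm_incr_adjoint_sq_le (S := S) b hA hC (zero_le (a := t)) le_rfl
  simp_rw [M.incr_zero_left hA] at hsum
  let L : G →ₗ[ℝ] Ω →ₘ[P] ℝ := M.M t A ∘ₗ (ContinuousLinearMap.adjoint S).toLinearMap
  obtain ⟨Z, hZm, hZ⟩ := exists_stronglyMeasurable_inner_ae_eq (ℱ.le t) b L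
    (fun g => (M.continuous A hA t _).comp ((ContinuousLinearMap.adjoint S).continuous.tendsto g))
    (fun g => (M.martingale A hA _).stronglyMeasurable t) (hsum.trans_lt hfinite).ne
  have hle := M.lintegral_enorm_sq_le_of_inner_ae_eq_incr (S := S) hA hC (zero_le (a := t)) le_rfl
    fun g => by
      rw [M.incr_zero_left hA]
      exact hZ g
  refine ⟨Z, hZm, ⟨(hZm.mono (ℱ.le t)).aestronglyMeasurable, ?_⟩, hZ⟩
  rw [eLpNorm_lt_top_iff_lintegral_rpow_enorm_lt_top two_ne_zero ENNReal.ofNat_ne_top]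
  simpa using hle.trans_lt hfinite

end CylMartingaleMeasure

section CadlagPaths

variable {G : Type*} [NormedAddCommGroup G] {T : ℝ≥0}

theorem isCadlag_const (g : G) : IsCadlag fun _ : Iic T => g := fun _ =>
  ⟨continuousWithinAt_const, g, tendsto_const_nhds⟩

theorem IsCadlag.sub {f g : Iic T → G} (hf : IsCadlag f) (hg : IsCadlag g) :
    IsCadlag fun t => f t - g t := fun t => by
  obtain ⟨⟨hfr, x, hx⟩, hgr, y, hy⟩ := And.intro (hf t) (hg t)
  exact ⟨hfr.sub hgr, x - y, hx.sub hy⟩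

end CadlagPaths

section StoppedMartingales

variable {Ω : Type*} {mΩ : MeasurableSpace Ω} {P : Measure Ω} [IsFiniteMeasure P]
  {G : Type*} [NormedAddCommGroup G] [InnerProductSpace ℝ G] [CompleteSpace G]
  {ι : Type*} [LinearOrder ι] {ℱ : Filtration ι mΩ} {X : ι → Ω → G}

theorem martingale_min_const (hX : Martingale X ℱ P) (t : ι) :
    Martingale (fun r => X (min t r)) ℱ P := by
  refine ⟨fun r => (hX.stronglyMeasurable _).mono (ℱ.mono (min_le_right _ _)), fun i j hij => ?_⟩
  rcases le_total i t with hit | hti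
  · simp only [min_eq_right hit]
    exact hX.condExp_ae_eq (le_min hit hij)
  · simp only [min_eq_left hti, min_eq_left (hti.trans hij)]
    rw [condExp_of_stronglyMeasurable (ℱ.le i) ((hX.stronglyMeasurable t).mono (ℱ.mono hti))
      (hX.integrable t)]

theorem martingale_indicator_of_ae_eq_zero [SecondCountableTopology G]
    (hnull : ∀ t, ∀ N : Set Ω, P N = 0 → MeasurableSet[ℱ t] N) (hX : Martingale X ℱ P) {s : ι}
    (hzero : ∀ r ≤ s, X r =ᵐ[P] 0) {F : Set Ω} (hF : MeasurableSet[ℱ s] F) :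
    Martingale (fun r => F.indicator (X r)) ℱ P := by
  have hFm : MeasurableSet F := ℱ.le s F hF
  have hFzero : ∀ r ≤ s, F.indicator (X r) =ᵐ[P] 0 := fun r hr => by
    filter_upwards [hzero r hr] with ω hω
    by_cases h : ω ∈ F <;> simp [h, hω]
  have hadapted : ∀ r, StronglyMeasurable[ℱ r] (F.indicator (X r)) := fun r => by
    rcases le_total s r with hsr | hrs
    · exact (hX.stronglyMeasurable r).indicator (ℱ.mono hsr F hF)
    · exact stronglyMeasurable_congr_of_null_mem (hnull r) stronglyMeasurable_zero
        (hFzero r hrs).symm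
  have hintegrable : ∀ r, Integrable (F.indicator (X r)) P := fun r =>
    (hX.integrable r).indicator hFm
  refine ⟨hadapted, fun i j hij => (ae_eq_condExp_of_forall_setIntegral_eq (ℱ.le i) (hintegrable j)
    (fun _ _ _ => (hintegrable i).integrableOn) (fun B hB _ => ?_)
    (hadapted i).aestronglyMeasurable).symm⟩
  rcases le_total s i with hsi | his
  · rw [setIntegral_indicator hFm, setIntegral_indicator hFm]
    exact hX.setIntegral_eq hij (hB.inter (ℱ.mono hsi F hF))
  · rw [integral_eq_zero_of_ae (ae_restrict_of_ae (hFzero i his))]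
    rcases le_total s j with hsj | hjs
    · rw [setIntegral_indicator hFm, ← hX.setIntegral_eq hsj ((ℱ.mono his B hB).inter hF),
        integral_eq_zero_of_ae (ae_restrict_of_ae (hzero s le_rfl))]
    · rw [integral_eq_zero_of_ae (ae_restrict_of_ae (hFzero j hjs))]

end StoppedMartingales

theorem measurableSet_restrictTime_of_null {Ω : Type*} {mΩ : MeasurableSpace Ω} {P : Measure Ω}
    {ℱ : Filtration ℝ≥0 mΩ} (hnull : ∀ N : Set Ω, P N = 0 → MeasurableSet[ℱ 0] N) {T : ℝ≥0}
    (t : Iic T) (N : Set Ω) (hN : P N = 0) : MeasurableSet[restrictTime ℱ T t] N :=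
  ℱ.mono (zero_le (a := (t : ℝ≥0))) N (hnull N hN)

namespace CylMartingaleMeasure

variable {Ω : Type*} {mΩ : MeasurableSpace Ω} {P : Measure Ω} {ℱ : Filtration ℝ≥0 mΩ}
  {H : Type*} [NormedAddCommGroup H] [InnerProductSpace ℝ H] [CompleteSpace H]
  {U : Type*} [TopologicalSpace U] [MeasurableSpace U]
  {M : CylMartingaleMeasure P ℱ H U} {T : ℝ≥0}
  {G : Type*} [NormedAddCommGroup G] [InnerProductSpace ℝ G] [CompleteSpace G]
  [TopologicalSpace.SeparableSpace G] {A : Set U} {S : H →L[ℝ] G}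

theorem IsRadonified.ae_eq {s t : ℝ≥0} {Y Y' : Iic T → Ω → G}
    (hY : M.IsRadonified T s t A S Y) (hY' : M.IsRadonified T s t A S Y') :
    ∀ᵐ ω ∂P, ∀ r, Y r ω = Y' r ω :=
  ae_forall_eq_of_forall_ae_eq (fun ω r => (hY.isMartingale.cadlag ω r).1)
    (fun ω r => (hY'.isMartingale.cadlag ω r).1) fun r =>
      ae_eq_of_forall_inner fun g => (hY.version r g).trans (hY'.version r g).symm

theorem IsRadonified.ae_eq_zero {s t : ℝ≥0} {Y : Iic T → Ω → G}
    (hY : M.IsRadonified T s t A S Y) (hst : s ≤ t) {r : Iic T} (hr : (r : ℝ≥0) ≤ s) :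
    Y r =ᵐ[P] 0 := by
  refine ae_eq_of_forall_inner fun g => (hY.version r g).trans ?_
  rw [min_eq_right hr, min_eq_right (hr.trans hst)]
  filter_upwards [M.coeFn_incr_self r A (ContinuousLinearMap.adjoint S g)] with ω hω
  simp [hω]

theorem tendstoInMeasure_of_inner_ae_eq_M_adjoint (hA : A ∈ M.ring) (hS : IsHilbertSchmidt S)
    {Z : ℝ≥0 → Ω → G} (hZm : ∀ t, AEStronglyMeasurable (Z t) P)
    (hZ : ∀ t g, (fun ω => ⟪Z t ω, g⟫) =ᵐ[P] M.M t A (ContinuousLinearMap.adjoint S g)) (t : ℝ≥0) :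
    TendstoInMeasure P Z (𝓝[≥] t) (Z t) := by
  obtain ⟨C, -, hC⟩ := M.exists_form_le (t + 1)
  have hfinite : ENNReal.ofReal C * M.μ A * hsNormSq S ≠ ∞ :=
    (ENNReal.mul_lt_top (ENNReal.mul_lt_top ENNReal.ofReal_lt_top (M.μ_lt_top A hA)) hS).ne
  have hlam : Tendsto (fun t' => M.lam (Ioc t t')) (𝓝[≥] t) (𝓝 0) := by
    have hright : ContinuousWithinAt (fun t' => M.lam (Ioc t t')) (Ioi t) t := by
      simpa [ContinuousWithinAt] using M.tendsto_lam_Ioc t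
    simpa [ContinuousWithinAt] using continuousWithinAt_Ioi_iff_Ici.1 hright
  have hbound := ENNReal.Tendsto.const_mul hlam (Or.inr hfinite)
  rw [mul_zero] at hbound
  refine tendstoInMeasure_of_tendsto_lintegral_enorm_sq hZm (hZm t)
    (tendsto_of_tendsto_of_tendsto_of_le_of_le' tendsto_const_nhds hbound
      (Eventually.of_forall fun _ => zero_le) ?_)
  filter_upwards [Icc_mem_nhdsGE (lt_add_one t)] with t' ht'
  refine (M.lintegral_enorm_sq_le_of_inner_ae_eq_incr (S := S) hA hC ht'.1 ht'.2
    (Z := fun ω => Z t' ω - Z t ω) fun g => ?_).trans_eq (mul_right_comm _ _ _)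
  filter_upwards [hZ t' g, hZ t g, M.coeFn_incr t t' A (ContinuousLinearMap.adjoint S g)]
    with ω hωt' hωt hω
  rw [inner_sub_left, hωt', hωt, hω]

variable [IsFiniteMeasure P] (hnull : ∀ N : Set Ω, P N = 0 → MeasurableSet[ℱ 0] N)
include hnull

theorem exists_isCadlagL2Martingale_inner_ae_eq_M_min_adjoint (hA : A ∈ M.ring)
    (hS : IsHilbertSchmidt S) (t : ℝ≥0) :
    ∃ Y : Iic T → Ω → G, IsCadlagL2Martingale P ℱ T Y ∧ ∀ (r : Iic T) g,
      (fun ω => ⟪Y r ω, g⟫) =ᵐ[P] M.M (min t r) A (ContinuousLinearMap.adjoint S g) := by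
  choose Z hZm hZ2 hZ using M.exists_stronglyMeasurable_inner_ae_eq_M_adjoint (G := G) hA hS
  have hmart : Martingale Z ℱ P := martingale_of_forall_inner hZm
    (fun r => (hZ2 r).integrable one_le_two)
    (fun g => M.martingale A hA (ContinuousLinearMap.adjoint S g)) hZ
  have hstopped : Martingale (fun r : Iic T => Z (min t r)) (restrictTime ℱ T) P :=
    ⟨fun r => (martingale_min_const hmart t).1 r,
      fun i j hij => (martingale_min_const hmart t).2 _ _ hij⟩
  have hrc : ∀ r : Iic T, TendstoInMeasure P (fun r : Iic T => Z (min t r)) (𝓝[>] r)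
      (Z (min t r)) := fun r => by
    have hmin : Tendsto (fun r : Iic T => min t (r : ℝ≥0)) (𝓝[>] r) (𝓝[≥] (min t (r : ℝ≥0))) :=
      tendsto_nhdsWithin_iff.2
        ⟨((continuous_const.min continuous_subtype_val).tendsto r).mono_left nhdsWithin_le_nhds,
          eventually_nhdsWithin_of_forall fun x hx => min_le_min_left t (le_of_lt hx)⟩
    exact (tendstoInMeasure_of_inner_ae_eq_M_adjoint hA hS (fun r => (hZ2 r).1) hZ _).comp hmin
  obtain ⟨Y, hY, hY2, hcadlag, hYZ⟩ := exists_cadlag_modification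
    (measurableSet_restrictTime_of_null hnull) hstopped (fun r => hZ2 _) hrc
  refine ⟨Y, ⟨hY, hY2, hcadlag⟩, fun r g => ?_⟩
  filter_upwards [hYZ r, hZ (min t r) g] with ω hωY hωZ
  rw [hωY, hωZ]

theorem exists_isRadonified (s t : ℝ≥0) (hA : A ∈ M.ring) (hS : IsHilbertSchmidt S) :
    ∃ Y : Iic T → Ω → G, M.IsRadonified T s t A S Y := by
  obtain ⟨Y, hY, hYt⟩ := exists_isCadlagL2Martingale_inner_ae_eq_M_min_adjoint hnull hA hS t
  obtain ⟨Y', hY', hYs⟩ := exists_isCadlagL2Martingale_inner_ae_eq_M_min_adjoint hnull hA hS s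
  refine ⟨fun r ω => Y r ω - Y' r ω, ⟨hY.martingale.sub hY'.martingale,
    fun r => (hY.memLp r).sub (hY'.memLp r), fun ω => (hY.cadlag ω).sub (hY'.cadlag ω)⟩,
    fun r g => ?_⟩
  filter_upwards [hYt r g, hYs r g,
    M.coeFn_incr (min s r) (min t r) A (ContinuousLinearMap.adjoint S g)] with ω hωt hωs hω
  rw [inner_sub_left, hωt, hωs, hω]

end CylMartingaleMeasure

/-! ### Elementary integrands -/

theorem integral_sum_sum_mul {α : Type*} {mα : MeasurableSpace α} {ν : Measure α} {κ : Type*}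
    (E : Finset κ) (a : κ → ℝ) {f : κ → κ → α → ℝ} (hf : ∀ k l, Integrable (f k l) ν) :
    ∫ z, ∑ k ∈ E, ∑ l ∈ E, a k * a l * f k l z ∂ν
      = ∑ k ∈ E, ∑ l ∈ E, a k * a l * ∫ z, f k l z ∂ν := by
  have hsmul : ∀ k l, Integrable (fun z => a k * a l * f k l z) ν := fun k l =>
    (hf k l).const_mul _
  rw [integral_finsetSum _ fun k _ => integrable_finsetSum _ fun l _ => hsmul k l]
  refine Finset.sum_congr rfl fun k _ => ?_
  rw [integral_finsetSum _ fun l _ => hsmul k l]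
  exact Finset.sum_congr rfl fun l _ => integral_const_mul _ _

namespace CylMartingaleMeasure

variable {Ω : Type*} {mΩ : MeasurableSpace Ω} {P : Measure Ω} {ℱ : Filtration ℝ≥0 mΩ}
  {H : Type*} [NormedAddCommGroup H] [InnerProductSpace ℝ H] [CompleteSpace H]
  {U : Type*} [TopologicalSpace U] [MeasurableSpace U]

/-- The data `(s, t, F, A, S)` of an elementary integrand `1_{]s, t]} 1_F 1_A S`, with a version of
the radonified process `Y(s, t, A, S)`. -/
structure Elementary (M : CylMartingaleMeasure P ℱ H U) (T : ℝ≥0)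
    (G : Type*) [NormedAddCommGroup G] [InnerProductSpace ℝ G] [CompleteSpace G] where
  s : ℝ≥0
  t : ℝ≥0
  F : Set Ω
  A : Set U
  S : H →L[ℝ] G
  Y : Iic T → Ω → G
  lt : s < t
  le : t ≤ T
  meas_F : MeasurableSet[ℱ s] F
  mem_A : A ∈ M.ring
  isRadonified : M.IsRadonified T s t A S Y

namespace Elementary

variable {M : CylMartingaleMeasure P ℱ H U} {T : ℝ≥0}
  {G : Type*} [NormedAddCommGroup G] [InnerProductSpace ℝ G] [CompleteSpace G]
  (e e' : M.Elementary T G)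

/-- The scalar factor `1_{]s, t]}(r) 1_F(ω) 1_A(u)` of the elementary integrand. -/
def coeff (r : ℝ≥0) (ω : Ω) (u : U) : ℝ :=
  (Ioc e.s e.t).indicator (1 : ℝ≥0 → ℝ) r * e.F.indicator (1 : Ω → ℝ) ω
    * e.A.indicator (1 : U → ℝ) u

/-- The elementary integrand as a family of operators on the spaces `H_{q_{r,u}}`. -/
def family : M.OpFamily G := fun r ω u =>
  e.coeff r ω u • e.S.comp (ContinuousLinearMap.adjoint (M.q r u).incl)

/-- The integral process `1_F Y(s, t, A, S)` of the elementary integrand. -/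
def process : Iic T → Ω → G := fun r => e.F.indicator (e.Y r)

/-- The projection `1_F M((s ∧ r, t ∧ r], A)(S* g)` of the integral process on `g`. -/
def proj (r : ℝ≥0) (g : G) : Ω → ℝ :=
  e.F.indicator (M.incr (min e.s r) (min e.t r) e.A (ContinuousLinearMap.adjoint e.S g))

/-- The set `]s, t] × A` outside which the elementary integrand vanishes. -/
def box : Set (ℝ≥0 × U) := Ioc e.s e.t ×ˢ e.A

theorem measurableSet_F : MeasurableSet e.F := ℱ.le _ _ e.meas_F

theorem measurableSet_box [BorelSpace U] : MeasurableSet e.box :=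
  measurableSet_Ioc.prod (M.measurableSet_of_mem_ring e.mem_A)

theorem memLp_proj (r : ℝ≥0) (g : G) : MemLp (e.proj r g) 2 P :=
  (M.memLp_incr e.mem_A _ _ _).indicator e.measurableSet_F

theorem proj_ae_eq_zero {r : ℝ≥0} (hr : r ≤ e.s) (g : G) : e.proj r g =ᵐ[P] 0 := by
  rw [proj, min_eq_right hr, min_eq_right (hr.trans e.lt.le)]
  filter_upwards [M.coeFn_incr_self r e.A (ContinuousLinearMap.adjoint e.S g)] with ω hω
  by_cases h : ω ∈ e.F <;> simp [h, hω]

theorem inner_process_ae_eq (r : Iic T) (g : G) :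
    (fun ω => ⟪e.process r ω, g⟫) =ᵐ[P] e.proj r g := by
  filter_upwards [e.isRadonified.version r g] with ω hω
  by_cases h : ω ∈ e.F
  · simpa [process, proj, h] using hω
  · simp [process, proj, h]

theorem process_ae_eq_zero [TopologicalSpace.SeparableSpace G] {r : Iic T}
    (hr : (r : ℝ≥0) ≤ e.s) : e.process r =ᵐ[P] 0 := by
  filter_upwards [e.isRadonified.ae_eq_zero e.lt.le hr] with ω hω
  by_cases h : ω ∈ e.F <;> simp [process, h, hω]

theorem process_mem_l2Martingales [IsFiniteMeasure P] [TopologicalSpace.SeparableSpace G]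
    (hnull : ∀ N : Set Ω, P N = 0 → MeasurableSet[ℱ 0] N) :
    e.process ∈ l2Martingales P ℱ T G := by
  have := UniformSpace.secondCountable_of_separable G
  have hY := e.isRadonified.isMartingale
  have hmart : Martingale e.process (restrictTime ℱ T) P :=
    martingale_indicator_of_ae_eq_zero (measurableSet_restrictTime_of_null hnull) hY.martingale
      (s := ⟨e.s, e.lt.le.trans e.le⟩) (fun r hr => e.isRadonified.ae_eq_zero e.lt.le hr) e.meas_F
  have hcadlag : ∀ ω, IsCadlag fun t => e.process t ω := fun ω => by
    by_cases h : ω ∈ e.F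
    · simpa [process, h] using hY.cadlag ω
    · simpa [process, h] using isCadlag_const (T := T) (0 : G)
  let zeroTime : Iic T := ⟨0, mem_Iic.2 zero_le⟩
  refine ⟨⟨hmart, fun t => (hY.memLp t).indicator e.measurableSet_F, hcadlag⟩, fun t => ?_⟩
  have hconst := hmart.setIntegral_eq (show zeroTime ≤ t from zero_le (a := (t : ℝ≥0)))
    MeasurableSet.univ
  rw [setIntegral_univ, setIntegral_univ] at hconst
  rw [← hconst]
  exact integral_eq_zero_of_ae (e.process_ae_eq_zero (r := zeroTime) zero_le)

theorem coeff_mul_coeff_mul (r : ℝ≥0) (ω : Ω) (u : U) (h h' : H) :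
    e.coeff r ω u * e'.coeff r ω u * (M.q r u).form h h'
      = (e.F ∩ e'.F).indicator (1 : Ω → ℝ) ω
        * (e.box ∩ e'.box).indicator (fun p : ℝ≥0 × U => (M.q p.1 p.2).form h h') (r, u) := by
  rw [coeff, coeff, inter_indicator_one, Pi.mul_apply,
    show (e.box ∩ e'.box).indicator (fun p : ℝ≥0 × U => (M.q p.1 p.2).form h h') (r, u)
        = (e.box ∩ e'.box).indicator 1 (r, u) * (M.q r u).form h h' by
      by_cases hp : (r, u) ∈ e.box ∩ e'.box <;> simp [hp],
    inter_indicator_one, Pi.mul_apply, box, box, indicator_prod_one, indicator_prod_one]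
  ring

section Combination

variable {κ : Type*} (E : Finset κ) (a : κ → ℝ) (v : κ → M.Elementary T G)

theorem adjoint_sum_family (r : ℝ≥0) (ω : Ω) (u : U) (g : G) :
    ContinuousLinearMap.adjoint ((∑ k ∈ E, a k • (v k).family) r ω u) g
      = (M.q r u).incl (∑ k ∈ E, (a k * (v k).coeff r ω u) •
        ContinuousLinearMap.adjoint (v k).S g) := by
  have heval : (∑ k ∈ E, a k • (v k).family) r ω u = ∑ k ∈ E, a k • (v k).family r ω u := by
    simp only [Finset.sum_apply, Pi.smul_apply]
  rw [heval, map_sum, _root_.sum_apply, map_sum]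
  refine Finset.sum_congr rfl fun k _ => ?_
  simp [family, smul_smul, ContinuousLinearMap.adjoint_comp]

theorem norm_adjoint_sum_family_sq (r : ℝ≥0) (ω : Ω) (u : U) (g : G) :
    ‖ContinuousLinearMap.adjoint ((∑ k ∈ E, a k • (v k).family) r ω u) g‖ ^ 2
      = ∑ k ∈ E, ∑ l ∈ E, a k * a l * ((v k).coeff r ω u * (v l).coeff r ω u
        * (M.q r u).form (ContinuousLinearMap.adjoint (v k).S g)
          (ContinuousLinearMap.adjoint (v l).S g)) := by
  rw [adjoint_sum_family, HilbertianSeminorm.norm_incl, HilbertianSeminorm.val_sq,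
    HilbertianSeminorm.form_sum]
  exact Finset.sum_congr rfl fun k _ => Finset.sum_congr rfl fun l _ => by ring

theorem inner_sum_process_ae_eq (r : Iic T) (g : G) :
    (fun ω => ⟪(∑ k ∈ E, a k • (v k).process) r ω, g⟫)
      =ᵐ[P] fun ω => ∑ k ∈ E, a k * (v k).proj r g ω := by
  filter_upwards [(Finset.eventually_all E).2 fun k _ => (v k).inner_process_ae_eq r g] with ω hω
  simp only [Finset.sum_apply, Pi.smul_apply, sum_inner, inner_smul_left, RCLike.conj_to_real]
  exact Finset.sum_congr rfl fun k hk => by rw [hω k hk]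

theorem memLp_sum_proj (r : ℝ≥0) (g : G) :
    MemLp (fun ω => ∑ k ∈ E, a k * (v k).proj r g ω) 2 P :=
  memLp_finsetSum E fun k _ => ((v k).memLp_proj r g).const_mul (a k)

end Combination

variable (M) in
/-- The measure `P ⊗ λ ⊗ μ` on `Ω × ]0, r] × U`, with respect to which the energy up to time `r` is
an integral. -/
def energyMeasure (r : ℝ≥0) : Measure (Ω × (ℝ≥0 × U)) :=
  P.prod ((M.lam.restrict (Ioc 0 r)).prod M.μ)

theorem restrict_box_inter_box (r : ℝ≥0) :
    ((M.lam.restrict (Ioc 0 r)).prod M.μ).restrict (e.box ∩ e'.box)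
      = M.timeSpace.restrict
        ((Ioc e.s (min e.t r) ∩ Ioc e'.s (min e'.t r)) ×ˢ (e.A ∩ e'.A)) := by
  rw [box, box, prod_inter_prod, ← Measure.prod_restrict, ← Measure.prod_restrict,
    Measure.restrict_restrict (measurableSet_Ioc.inter measurableSet_Ioc)]
  congr 2
  ext x
  simp only [mem_inter_iff, mem_Ioc, le_min_iff]
  constructor
  · rintro ⟨⟨⟨hs, ht⟩, hs', ht'⟩, -, hr⟩
    exact ⟨⟨hs, ht, hr⟩, hs', ht', hr⟩
  · rintro ⟨⟨hs, ht, hr⟩, hs', ht', -⟩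
    exact ⟨⟨⟨hs, ht⟩, hs', ht'⟩, zero_le.trans_lt hs, hr⟩

variable [BorelSpace U]

theorem measurable_coeff : Measurable fun z : Ω × (ℝ≥0 × U) => e.coeff z.2.1 z.1 z.2.2 := by
  have htime : Measurable ((Ioc e.s e.t).indicator (1 : ℝ≥0 → ℝ)) :=
    measurable_one.indicator measurableSet_Ioc
  have hevent : Measurable (e.F.indicator (1 : Ω → ℝ)) := measurable_one.indicator e.measurableSet_F
  have hspace : Measurable (e.A.indicator (1 : U → ℝ)) :=
    measurable_one.indicator (M.measurableSet_of_mem_ring e.mem_A)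
  exact ((htime.comp (measurable_fst.comp measurable_snd)).mul (hevent.comp measurable_fst)).mul
    (hspace.comp (measurable_snd.comp measurable_snd))

variable {κ : Type*} (E : Finset κ) (a : κ → ℝ) (v : κ → M.Elementary T G)

theorem measurable_enorm_adjoint_sum_family_sq (g : G) :
    Measurable fun z : Ω × (ℝ≥0 × U) => ‖ContinuousLinearMap.adjoint
        ((∑ k ∈ E, a k • (v k).family) z.2.1 z.1 z.2.2) g‖ₑ ^ 2 := by
  simp_rw [← ofReal_norm, ← ENNReal.ofReal_pow (norm_nonneg _), norm_adjoint_sum_family_sq]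
  refine Measurable.ennreal_ofReal (Finset.measurable_sum _ fun k _ =>
    Finset.measurable_sum _ fun l _ => Measurable.const_mul ?_ _)
  exact ((v k).measurable_coeff.mul (v l).measurable_coeff).mul
    ((M.measurable_q _ _).comp measurable_snd)

theorem energy_sum_family {ι : Type*} [Countable ι] (b : HilbertBasis ι ℝ G) (r : ℝ≥0) :
    M.energy (∑ k ∈ E, a k • (v k).family) r
      = ∑' i, ∫⁻ z, ‖ContinuousLinearMap.adjoint
        ((∑ k ∈ E, a k • (v k).family) z.2.1 z.1 z.2.2) (b i)‖ₑ ^ 2 ∂(energyMeasure M r) := by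
  have hm := fun i => measurable_enorm_adjoint_sum_family_sq E a v (b i)
  rw [← lintegral_tsum fun i => (hm i).aemeasurable, energyMeasure,
    lintegral_prod _ (Measurable.tsum hm).aemeasurable, energy]
  refine lintegral_congr fun ω => ?_
  simp_rw [hsNormSq_eq_tsum_adjoint b]
  exact (lintegral_prod _ ((Measurable.tsum hm).comp
    (measurable_prodMk_left (x := ω))).aemeasurable).symm

variable [IsFiniteMeasure P]

theorem integrable_coeff_mul_coeff_mul_form (r : ℝ≥0) (h h' : H) :
    Integrable (fun z : Ω × (ℝ≥0 × U) => e.coeff z.2.1 z.1 z.2.2 * e'.coeff z.2.1 z.1 z.2.2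
      * (M.q z.2.1 z.2.2).form h h') (energyMeasure M r) := by
  simp_rw [coeff_mul_coeff_mul]
  refine Integrable.mul_prod (f := (e.F ∩ e'.F).indicator (1 : Ω → ℝ))
    ((integrable_const (1 : ℝ)).indicator (e.measurableSet_F.inter e'.measurableSet_F)) ?_
  rw [integrable_indicator_iff (e.measurableSet_box.inter e'.measurableSet_box), IntegrableOn,
    restrict_box_inter_box]
  exact M.integrableOn_form (M.isSetRing.inter_mem e.mem_A e'.mem_A) (T := e.t)
    (prod_mono (fun x hx => hx.1.2.trans (min_le_left _ _)) le_rfl) h h'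

variable (hnull : ∀ N : Set Ω, P N = 0 → MeasurableSet[ℱ 0] N)
include hnull

theorem integral_proj_mul_proj (r : ℝ≥0) (g : G) :
    ∫ ω, e.proj r g ω * e'.proj r g ω ∂P
      = P.real (e.F ∩ e'.F)
        * ∫ p in (Ioc e.s (min e.t r) ∩ Ioc e'.s (min e'.t r)) ×ˢ (e.A ∩ e'.A),
          (M.q p.1 p.2).form (ContinuousLinearMap.adjoint e.S g)
            (ContinuousLinearMap.adjoint e'.S g) ∂M.timeSpace := by
  rcases le_total r e.s with hr | hr
  · rw [Ioc_eq_empty_of_le ((min_le_right _ _).trans hr), integral_eq_zero_of_ae (μ := P)]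
    · simp
    · filter_upwards [e.proj_ae_eq_zero hr g] with ω hω
      simp [hω]
  rcases le_total r e'.s with hr' | hr'
  · rw [Ioc_eq_empty_of_le ((min_le_right e'.t r).trans hr'), integral_eq_zero_of_ae (μ := P)]
    · simp
    · filter_upwards [e'.proj_ae_eq_zero hr' g] with ω hω
      simp [hω]
  rw [proj, proj, min_eq_left hr, min_eq_left hr',
    M.integral_indicator_incr_mul_indicator_incr hnull e.mem_A e'.mem_A (le_min e.lt.le hr)
      (le_min e'.lt.le hr') _ _ e.meas_F e'.meas_F]

theorem integral_coeff_mul_coeff_mul_form (r : ℝ≥0) (g : G) :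
    ∫ z, e.coeff z.2.1 z.1 z.2.2 * e'.coeff z.2.1 z.1 z.2.2
      * (M.q z.2.1 z.2.2).form (ContinuousLinearMap.adjoint e.S g)
        (ContinuousLinearMap.adjoint e'.S g) ∂(energyMeasure M r)
      = ∫ ω, e.proj r g ω * e'.proj r g ω ∂P := by
  simp_rw [coeff_mul_coeff_mul]
  rw [energyMeasure, integral_prod_mul ((e.F ∩ e'.F).indicator (1 : Ω → ℝ)),
    integral_indicator_one (e.measurableSet_F.inter e'.measurableSet_F),
    integral_indicator (e.measurableSet_box.inter e'.measurableSet_box), restrict_box_inter_box,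
    integral_proj_mul_proj e e' hnull]

theorem lintegral_enorm_adjoint_sum_family_sq (r : ℝ≥0) (g : G) :
    ∫⁻ z, ‖ContinuousLinearMap.adjoint
        ((∑ k ∈ E, a k • (v k).family) z.2.1 z.1 z.2.2) g‖ₑ ^ 2 ∂(energyMeasure M r)
      = ∫⁻ ω, ‖∑ k ∈ E, a k * (v k).proj r g ω‖ₑ ^ 2 ∂P := by
  have hintegrable := fun k l => (v k).integrable_coeff_mul_coeff_mul_form (v l) r
    (ContinuousLinearMap.adjoint (v k).S g) (ContinuousLinearMap.adjoint (v l).S g)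
  have hintegrable' := fun k l => ((v k).memLp_proj r g).integrable_mul ((v l).memLp_proj r g)
  have hsq : ∀ ω, ‖∑ k ∈ E, a k * (v k).proj r g ω‖ ^ 2
      = ∑ k ∈ E, ∑ l ∈ E, a k * a l * ((v k).proj r g * (v l).proj r g) ω := fun ω => by
    rw [Real.norm_eq_abs, sq_abs, sq, Finset.sum_mul_sum]
    exact Finset.sum_congr rfl fun k _ => Finset.sum_congr rfl fun l _ => by
      rw [Pi.mul_apply]
      ring
  simp_rw [lintegral_enorm_sq_eq_ofReal_integral (memLp_sum_proj E a v r g), hsq,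
    ← ofReal_norm, ← ENNReal.ofReal_pow (norm_nonneg _)]
  rw [← ofReal_integral_eq_lintegral_ofReal _ (ae_of_all _ fun z => by positivity)]
  · simp_rw [norm_adjoint_sum_family_sq]
    rw [integral_sum_sum_mul E a hintegrable, integral_sum_sum_mul E a hintegrable']
    simp_rw [integral_coeff_mul_coeff_mul_form _ _ hnull, Pi.mul_apply]
  · simp_rw [norm_adjoint_sum_family_sq]
    exact integrable_finsetSum _ fun k _ => integrable_finsetSum _ fun l _ =>
      (hintegrable k l).const_mul _

theorem lintegral_enorm_sum_process_sq [TopologicalSpace.SeparableSpace G] (r : Iic T) :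
    ∫⁻ ω, ‖(∑ k ∈ E, a k • (v k).process) r ω‖ₑ ^ 2 ∂P
      = M.energy (∑ k ∈ E, a k • (v k).family) r := by
  obtain ⟨w, b, -⟩ := exists_hilbertBasis ℝ G
  have := countable_of_orthonormal b.orthonormal
  rw [energy_sum_family E a v b, lintegral_enorm_sq_eq_tsum_of_inner_ae_eq b
    (fun i => (memLp_sum_proj E a v r (b i)).1) fun i => inner_sum_process_ae_eq E a v r (b i)]
  simp_rw [lintegral_enorm_adjoint_sum_family_sq E a v hnull]

end Elementary

end CylMartingaleMeasure

/-! ### Separated representations -/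

section HilbertSchmidtSums

variable {E F : Type*} [NormedAddCommGroup E] [InnerProductSpace ℝ E] [CompleteSpace E]
  [NormedAddCommGroup F] [InnerProductSpace ℝ F]

theorem hsNormSq_add_le (S R : E →L[ℝ] F) :
    hsNormSq (S + R) ≤ 2 * (hsNormSq S + hsNormSq R) := by
  simp only [hsNormSq]
  rw [← ENNReal.tsum_add, ← ENNReal.tsum_mul_left]
  refine ENNReal.tsum_le_tsum fun e => (pow_le_pow_left' (enorm_add_le _ _) 2).trans ?_
  have hconvex := ENNReal.rpow_add_le_mul_rpow_add_rpow ‖S e‖ₑ ‖R e‖ₑ (one_le_two (α := ℝ))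
  norm_num at hconvex
  exact hconvex

theorem IsHilbertSchmidt.sum {κ : Type*} (J : Finset κ) {S : κ → E →L[ℝ] F}
    (hS : ∀ k, IsHilbertSchmidt (S k)) : IsHilbertSchmidt (∑ k ∈ J, S k) := by
  refine Finset.sum_induction _ _ (fun A B hA hB => ?_) IsHilbertSchmidt.zero fun k _ => hS k
  exact (hsNormSq_add_le A B).trans_lt
    (ENNReal.mul_lt_top (by simp) (ENNReal.add_lt_top.2 ⟨hA, hB⟩))

end HilbertSchmidtSums

namespace CylMartingaleMeasure.SimpleRep

variable {Ω : Type*} {mΩ : MeasurableSpace Ω} {P : Measure Ω} {ℱ : Filtration ℝ≥0 mΩ}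
  {H : Type*} [NormedAddCommGroup H] [InnerProductSpace ℝ H] [CompleteSpace H]
  {U : Type*} [TopologicalSpace U] [MeasurableSpace U]
  {M : CylMartingaleMeasure P ℱ H U} {T : ℝ≥0}
  {G : Type*} [NormedAddCommGroup G] [InnerProductSpace ℝ G] [CompleteSpace G]

section Cells

variable (R : M.SimpleRep T G)

/-- The endpoints of the time intervals of a representation. -/
def endpoints : Finset ℝ≥0 := Finset.univ.image R.s ∪ Finset.univ.image R.t

theorem s_mem_endpoints (i : Fin R.n) : R.s i ∈ R.endpoints :=
  Finset.mem_union_left _ (Finset.mem_image_of_mem _ (Finset.mem_univ i))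

theorem t_mem_endpoints (i : Fin R.n) : R.t i ∈ R.endpoints :=
  Finset.mem_union_right _ (Finset.mem_image_of_mem _ (Finset.mem_univ i))

theorem le_of_mem_endpoints {x : ℝ≥0} (hx : x ∈ R.endpoints) : x ≤ T := by
  rcases Finset.mem_union.1 hx with h | h <;> obtain ⟨i, -, rfl⟩ := Finset.mem_image.1 h
  · exact (R.lt i).le.trans (R.le i)
  · exact R.le i

/-- The cells of the time grid of a representation: pairs of consecutive endpoints. -/
def Cell : Type :=
  {p : R.endpoints × R.endpoints //
    (p.1 : ℝ≥0) < p.2 ∧ ∀ x ∈ R.endpoints, ¬((p.1 : ℝ≥0) < x ∧ x < (p.2 : ℝ≥0))}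

instance : Fintype R.Cell := by
  classical
  exact inferInstanceAs (Fintype {p : R.endpoints × R.endpoints //
    (p.1 : ℝ≥0) < p.2 ∧ ∀ x ∈ R.endpoints, ¬((p.1 : ℝ≥0) < x ∧ x < (p.2 : ℝ≥0))})

variable {R}

/-- The left endpoint of a cell. -/
def Cell.left (c : R.Cell) : ℝ≥0 := c.1.1

/-- The right endpoint of a cell. -/
def Cell.right (c : R.Cell) : ℝ≥0 := c.1.2

theorem Cell.left_lt_right (c : R.Cell) : c.left < c.right := c.2.1

theorem Cell.right_le (c : R.Cell) : c.right ≤ T := R.le_of_mem_endpoints c.1.2.2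

theorem Cell.le_left_or_right_le (c : R.Cell) {x : ℝ≥0} (hx : x ∈ R.endpoints) :
    x ≤ c.left ∨ c.right ≤ x := by
  by_contra! h
  exact c.2.2 x hx h

theorem Cell.left_le_and_right_le {c c' : R.Cell} {r : ℝ≥0} (hr : r ∈ Ioc c.left c.right)
    (hr' : r ∈ Ioc c'.left c'.right) : c.left ≤ c'.left ∧ c.right ≤ c'.right :=
  ⟨(c'.le_left_or_right_le c.1.1.2).resolve_right (hr.1.trans_le hr'.2).not_ge,
    (c.le_left_or_right_le c'.1.2.2).resolve_left (hr.1.trans_le hr'.2).not_ge⟩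

theorem Cell.eq_of_mem_of_mem {c c' : R.Cell} {r : ℝ≥0} (hr : r ∈ Ioc c.left c.right)
    (hr' : r ∈ Ioc c'.left c'.right) : c = c' := by
  obtain ⟨hleft, hright⟩ := left_le_and_right_le hr hr'
  obtain ⟨hleft', hright'⟩ := left_le_and_right_le hr' hr
  exact Subtype.ext (Prod.ext (Subtype.ext (hleft.antisymm hleft'))
    (Subtype.ext (hright.antisymm hright')))

theorem Cell.mem_Ioc_iff {c : R.Cell} {r : ℝ≥0} (hr : r ∈ Ioc c.left c.right) (i : Fin R.n) :
    r ∈ Ioc (R.s i) (R.t i) ↔ R.s i ≤ c.left ∧ c.left < R.t i := by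
  constructor
  · rintro ⟨hs, ht⟩
    exact ⟨(c.le_left_or_right_le (R.s_mem_endpoints i)).resolve_right (hs.trans_le hr.2).not_ge,
      hr.1.trans_le ht⟩
  · rintro ⟨hs, ht⟩
    exact ⟨hs.trans_lt hr.1,
      hr.2.trans ((c.le_left_or_right_le (R.t_mem_endpoints i)).resolve_left ht.not_ge)⟩

theorem exists_cell_mem {i : Fin R.n} {r : ℝ≥0} (hr : r ∈ Ioc (R.s i) (R.t i)) :
    ∃ c : R.Cell, r ∈ Ioc c.left c.right := by
  classical
  have hbelow : (R.endpoints.filter (· < r)).Nonempty :=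
    ⟨R.s i, Finset.mem_filter.2 ⟨R.s_mem_endpoints i, hr.1⟩⟩
  have habove : (R.endpoints.filter (r ≤ ·)).Nonempty :=
    ⟨R.t i, Finset.mem_filter.2 ⟨R.t_mem_endpoints i, hr.2⟩⟩
  obtain ⟨hleft, hlt⟩ := Finset.mem_filter.1 (Finset.max'_mem _ hbelow)
  obtain ⟨hright, hle⟩ := Finset.mem_filter.1 (Finset.min'_mem _ habove)
  refine ⟨⟨(⟨_, hleft⟩, ⟨_, hright⟩), hlt.trans_le hle, fun x hx hbetween => ?_⟩, hlt, hle⟩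
  rcases lt_or_ge x r with hxr | hrx
  · exact (Finset.le_max' _ x (Finset.mem_filter.2 ⟨hx, hxr⟩)).not_gt hbetween.1
  · exact (Finset.min'_le _ x (Finset.mem_filter.2 ⟨hx, hrx⟩)).not_gt hbetween.2

end Cells

section Refinement

variable (R : M.SimpleRep T G)

open Classical in
/-- The terms of a representation that are active just after time `x` in the outcome `ω`. -/
def activeTerms (x : ℝ≥0) (ω : Ω) : Finset (Fin R.n) :=
  Finset.univ.filter fun i => (R.s i ≤ x ∧ x < R.t i) ∧ ω ∈ R.F i

theorem measurableSet_activeTerms_eq (x : ℝ≥0) (J : Finset (Fin R.n)) :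
    MeasurableSet[ℱ x] {ω | R.activeTerms x ω = J} := by
  have hinter : {ω | R.activeTerms x ω = J}
      = ⋂ i, {ω | ((R.s i ≤ x ∧ x < R.t i) ∧ ω ∈ R.F i) ↔ i ∈ J} := by
    ext ω
    simp [activeTerms, Finset.ext_iff]
  rw [hinter]
  refine MeasurableSet.iInter fun i => ?_
  have hterm : MeasurableSet[ℱ x] {ω | (R.s i ≤ x ∧ x < R.t i) ∧ ω ∈ R.F i} := by
    by_cases hx : R.s i ≤ x ∧ x < R.t i
    · simpa [hx] using ℱ.mono hx.1 _ (R.meas_F i)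
    · simp [hx]
  by_cases hi : i ∈ J
  · simpa [hi] using hterm
  · simp only [hi, iff_false]
    exact hterm.compl

/-- The separated representation of the same simple integrand: on each cell of the time grid, `Ω` is
partitioned according to the set of active terms. -/
def refine : M.SimpleRep T G :=
  let k := Fintype.equivFin (R.Cell × Finset (Fin R.n))
  { n := Fintype.card (R.Cell × Finset (Fin R.n))
    m := R.m
    s := fun i => (k.symm i).1.left
    t := fun i => (k.symm i).1.right
    F := fun i => {ω | R.activeTerms (k.symm i).1.left ω = (k.symm i).2}
    A := R.A
    S := fun i j => ∑ l ∈ (k.symm i).2, R.S l j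
    lt := fun i => (k.symm i).1.left_lt_right
    le := fun i => (k.symm i).1.right_le
    meas_F := fun _ => R.measurableSet_activeTerms_eq _ _
    mem_A := R.mem_A
    hs := fun _ j => IsHilbertSchmidt.sum _ fun l => R.hs l j }

theorem isSeparated_refine : R.refine.IsSeparated := by
  rintro a b hab ⟨r, ha, hb⟩
  let k := Fintype.equivFin (R.Cell × Finset (Fin R.n))
  have hcell : (k.symm a).1 = (k.symm b).1 := Cell.eq_of_mem_of_mem ha hb
  refine ⟨congr_arg (fun c : R.Cell => Ioc c.left c.right) hcell,
    Set.disjoint_left.2 fun ω hωa hωb => hab (k.symm.injective (Prod.ext hcell ?_))⟩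
  have hactive : R.activeTerms (k.symm a).1.left ω = (k.symm a).2 := hωa
  have hactive' : R.activeTerms (k.symm b).1.left ω = (k.symm b).2 := hωb
  rw [← hactive, ← hactive', hcell]

/-- The factor `∑ⱼ 1_{Aⱼ}(u) Sᵢⱼ ∘ i*_{q_{r,u}}` of the `i`-th term of a simple integrand. -/
def spaceFactor (i : Fin R.n) (r : ℝ≥0) (u : U) : (M.q r u).Space →L[ℝ] G :=
  ∑ j, (R.A j).indicator (1 : U → ℝ) u •
    (R.S i j).comp (ContinuousLinearMap.adjoint (M.q r u).incl)

theorem toFamily_eq_sum_spaceFactor (r : ℝ≥0) (ω : Ω) (u : U) :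
    R.toFamily r ω u = ∑ i, ((Ioc (R.s i) (R.t i)).indicator (1 : ℝ≥0 → ℝ) r
      * (R.F i).indicator (1 : Ω → ℝ) ω) • R.spaceFactor i r u := by
  simp only [toFamily, spaceFactor, Finset.smul_sum, smul_smul]

theorem toFamily_eq_sum_activeTerms {c : R.Cell} {r : ℝ≥0} (hr : r ∈ Ioc c.left c.right) (ω : Ω)
    (u : U) : R.toFamily r ω u = ∑ i ∈ R.activeTerms c.left ω, R.spaceFactor i r u := by
  classical
  rw [toFamily_eq_sum_spaceFactor, activeTerms, Finset.sum_filter]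
  refine Finset.sum_congr rfl fun i _ => ?_
  simp only [← Cell.mem_Ioc_iff hr i]
  by_cases hri : r ∈ Ioc (R.s i) (R.t i) <;> by_cases hω : ω ∈ R.F i <;> simp [hri, hω]

theorem toFamily_refine_eq_sum_activeTerms (r : ℝ≥0) (ω : Ω) (u : U) :
    R.refine.toFamily r ω u = ∑ c : R.Cell, (Ioc c.left c.right).indicator (1 : ℝ≥0 → ℝ) r •
      ∑ i ∈ R.activeTerms c.left ω, R.spaceFactor i r u := by
  classical
  let k := Fintype.equivFin (R.Cell × Finset (Fin R.n))
  have hspace : ∀ i : Fin R.refine.n,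
      R.refine.spaceFactor i r u = ∑ l ∈ (k.symm i).2, R.spaceFactor l r u := fun i => by
    change ∑ j : Fin R.m, (R.A j).indicator (1 : U → ℝ) u •
      (∑ l ∈ (k.symm i).2, R.S l j).comp (ContinuousLinearMap.adjoint (M.q r u).incl) = _
    simp only [spaceFactor, ContinuousLinearMap.finsetSum_comp, Finset.smul_sum]
    exact Finset.sum_comm
  have hsum : R.refine.toFamily r ω u = ∑ c : R.Cell, ∑ J : Finset (Fin R.n),
      ((Ioc c.left c.right).indicator (1 : ℝ≥0 → ℝ) r
        * {ω | R.activeTerms c.left ω = J}.indicator (1 : Ω → ℝ) ω) •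
          ∑ i ∈ J, R.spaceFactor i r u := by
    rw [toFamily_eq_sum_spaceFactor, ← Fintype.sum_prod_type', ← k.symm.sum_comp]
    exact Finset.sum_congr rfl fun i _ => by rw [hspace]; rfl
  rw [hsum]
  refine Finset.sum_congr rfl fun c _ => ?_
  rw [Finset.sum_eq_single (R.activeTerms c.left ω)]
  · simp
  · intro J _ hJ
    simp [hJ.symm]
  · simp

theorem toFamily_refine : R.refine.toFamily = R.toFamily := by
  funext r ω u
  rw [toFamily_refine_eq_sum_activeTerms]
  by_cases hcell : ∃ c : R.Cell, r ∈ Ioc c.left c.right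
  · obtain ⟨c, hr⟩ := hcell
    rw [R.toFamily_eq_sum_activeTerms hr, Finset.sum_eq_single c]
    · simp [hr]
    · intro c' _ hne
      have hr' : r ∉ Ioc c'.left c'.right := fun h => hne (Cell.eq_of_mem_of_mem h hr)
      rw [indicator_of_notMem hr', zero_smul]
    · simp
  · have hcells : ∀ c : R.Cell, r ∉ Ioc c.left c.right := not_exists.1 hcell
    have hterms : ∀ i, r ∉ Ioc (R.s i) (R.t i) := fun i hr => hcell (exists_cell_mem hr)
    rw [toFamily_eq_sum_spaceFactor]
    simp only [indicator_of_notMem (hcells _), indicator_of_notMem (hterms _), zero_mul, zero_smul,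
      Finset.sum_const_zero]

end Refinement

end CylMartingaleMeasure.SimpleRep

/-! ### The integral of simple integrands -/

namespace CylMartingaleMeasure

variable {Ω : Type*} {mΩ : MeasurableSpace Ω} {P : Measure Ω} {ℱ : Filtration ℝ≥0 mΩ}
  {H : Type*} [NormedAddCommGroup H] [InnerProductSpace ℝ H] [CompleteSpace H]
  {U : Type*} [TopologicalSpace U] [MeasurableSpace U]
  {M : CylMartingaleMeasure P ℱ H U} {T : ℝ≥0}
  {G : Type*} [NormedAddCommGroup G] [InnerProductSpace ℝ G] [CompleteSpace G]
  {Φ : M.OpFamily G} {X X' : Iic T → Ω → G}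

variable (M T G) in
/-- The linear relation spanned by the pairs of an elementary integrand and its integral process. It
relates a simple integrand to all the processes computed from its representations, separated or not,
and from arbitrary versions of the radonified processes. -/
def integralRelation : Submodule ℝ (M.OpFamily G × (Iic T → Ω → G)) :=
  Submodule.span ℝ (range fun e : M.Elementary T G => (e.family, e.process))

theorem mem_integralRelation_of_isSimpleIntegral (hX : M.IsSimpleIntegral T Φ X) :
    (Φ, X) ∈ M.integralRelation T G := by
  obtain ⟨R, Y, -, rfl, hY, hXY⟩ := hX
  let e : Fin R.n → Fin R.m → M.Elementary T G := fun i j =>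
    ⟨R.s i, R.t i, R.F i, R.A j, R.S i j, Y i j, R.lt i, R.le i, R.meas_F i, R.mem_A j, hY i j⟩
  have hsum : (R.toFamily, X) = ∑ i, ∑ j, ((e i j).family, (e i j).process) := by
    refine Prod.ext ?_ ?_
    · funext r ω u
      simp only [Prod.fst_sum, Finset.sum_apply]
      rfl
    · funext t ω
      simp only [Prod.snd_sum, Finset.sum_apply]
      exact hXY t ω
  rw [hsum]
  exact Submodule.sum_mem _ fun i _ => Submodule.sum_mem _ fun j _ =>
    Submodule.subset_span ⟨e i j, rfl⟩

variable [TopologicalSpace.SeparableSpace G] [IsFiniteMeasure P]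
  (hnull : ∀ N : Set Ω, P N = 0 → MeasurableSet[ℱ 0] N)
include hnull

theorem mem_l2Martingales_of_mem_integralRelation (hX : (Φ, X) ∈ M.integralRelation T G) :
    X ∈ l2Martingales P ℱ T G := by
  have hle : M.integralRelation T G ≤ (l2Martingales P ℱ T G).comap (LinearMap.snd ℝ _ _) := by
    rw [integralRelation, Submodule.span_le]
    rintro _ ⟨e, rfl⟩
    exact e.process_mem_l2Martingales hnull
  exact hle hX

theorem exists_isSimpleIntegral (hΦ : Φ ∈ simpleIntegrands M T G) :
    ∃ X, M.IsSimpleIntegral T Φ X := by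
  obtain ⟨R, rfl⟩ := hΦ
  choose Y hY using fun i j => exists_isRadonified (M := M) (T := T) hnull (R.refine.s i)
    (R.refine.t i) (R.refine.mem_A j) (R.refine.hs i j)
  exact ⟨_, R.refine, Y, R.isSeparated_refine, R.toFamily_refine, hY, fun _ _ => rfl⟩

theorem exists_mem_integralRelation (Φ : M.simpleIntegrands T G) :
    ∃ X, ((Φ : M.OpFamily G), X) ∈ M.integralRelation T G :=
  (exists_isSimpleIntegral hnull Φ.2).imp fun _ => mem_integralRelation_of_isSimpleIntegral

variable [BorelSpace U]

theorem lintegral_enorm_sq_of_mem_integralRelation (hX : (Φ, X) ∈ M.integralRelation T G)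
    (t : Iic T) : ∫⁻ ω, ‖X t ω‖ₑ ^ 2 ∂P = M.energy Φ t := by
  obtain ⟨c, hc⟩ := Finsupp.mem_span_range_iff_exists_finsupp.1 hX
  have hfamily : Φ = ∑ e ∈ c.support, c e • e.family := by
    simpa [Finsupp.sum, Prod.fst_sum] using (congr_arg Prod.fst hc).symm
  have hprocess : X = ∑ e ∈ c.support, c e • e.process := by
    simpa [Finsupp.sum, Prod.snd_sum] using (congr_arg Prod.snd hc).symm
  rw [hfamily, hprocess]
  exact Elementary.lintegral_enorm_sum_process_sq c.support c id hnull t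

theorem ae_forall_eq_of_mem_integralRelation (hX : (Φ, X) ∈ M.integralRelation T G)
    (hX' : (Φ, X') ∈ M.integralRelation T G) : ∀ᵐ ω ∂P, ∀ t, X t ω = X' t ω := by
  have hXmart := (mem_l2Martingales_of_mem_integralRelation hnull hX).1
  have hXmart' := (mem_l2Martingales_of_mem_integralRelation hnull hX').1
  refine ae_forall_eq_of_forall_ae_eq (fun ω t => (hXmart.cadlag ω t).1)
    (fun ω t => (hXmart'.cadlag ω t).1) fun t => ?_
  have hsub : ((0 : M.OpFamily G), X - X') ∈ M.integralRelation T G := by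
    simpa using Submodule.sub_mem _ hX hX'
  have henergy : M.energy (0 : M.OpFamily G) t = 0 := by simp [energy, hsNormSq]
  have hzero : ∫⁻ ω, ‖(X t - X' t) ω‖ₑ ^ 2 ∂P = 0 :=
    (lintegral_enorm_sq_of_mem_integralRelation hnull hsub t).trans henergy
  rw [lintegral_eq_zero_iff'
    (((hXmart.memLp t).sub (hXmart'.memLp t)).1.enorm.pow_const 2)] at hzero
  filter_upwards [hzero] with ω hω
  simpa [sub_eq_zero] using hω

theorem mk_eq_mk_of_mem_integralRelation (hX : (Φ, X) ∈ M.integralRelation T G)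
    (hX' : (Φ, X') ∈ M.integralRelation T G) :
    (Submodule.Quotient.mk ⟨X, mem_l2Martingales_of_mem_integralRelation hnull hX⟩ : M2 P ℱ T G)
      = Submodule.Quotient.mk ⟨X', mem_l2Martingales_of_mem_integralRelation hnull hX'⟩ := by
  refine (Submodule.Quotient.eq _).2 ?_
  filter_upwards [ae_forall_eq_of_mem_integralRelation hnull hX hX'] with ω hω t
  exact sub_eq_zero.2 (hω t)

variable (M T G) in
/-- The stochastic integral `I` of simple integrands: the class of any process that the integral
relation relates to the integrand. -/
def simpleIntegral : M.simpleIntegrands T G →ₗ[ℝ] M2 P ℱ T G where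
  toFun Φ := Submodule.Quotient.mk ⟨_, mem_l2Martingales_of_mem_integralRelation hnull
    (exists_mem_integralRelation hnull Φ).choose_spec⟩
  map_add' Φ Ψ := mk_eq_mk_of_mem_integralRelation hnull
    (exists_mem_integralRelation hnull (Φ + Ψ)).choose_spec
    (Submodule.add_mem _ (exists_mem_integralRelation hnull Φ).choose_spec
      (exists_mem_integralRelation hnull Ψ).choose_spec)
  map_smul' a Φ := mk_eq_mk_of_mem_integralRelation hnull
    (exists_mem_integralRelation hnull (a • Φ)).choose_spec
    (Submodule.smul_mem _ a (exists_mem_integralRelation hnull Φ).choose_spec)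

theorem simpleIntegral_eq_mk {Φ : M.simpleIntegrands T G}
    (hX : ((Φ : M.OpFamily G), X) ∈ M.integralRelation T G) :
    M.simpleIntegral T G hnull Φ
      = Submodule.Quotient.mk ⟨X, mem_l2Martingales_of_mem_integralRelation hnull hX⟩ :=
  mk_eq_mk_of_mem_integralRelation hnull (exists_mem_integralRelation hnull Φ).choose_spec hX

theorem norm_simpleIntegral_le (Φ : M.simpleIntegrands T G) :
    (M.simpleIntegral T G hnull Φ).norm ≤ 2 * M.lambdaNorm T (Φ : M.OpFamily G) := by
  obtain ⟨X, hX⟩ := exists_mem_integralRelation hnull Φ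
  have hmart := (mem_l2Martingales_of_mem_integralRelation hnull hX).1
  have hdoob := lintegral_iSup_enorm_sq_le hmart.martingale hmart.memLp
    fun ω t => (hmart.cadlag ω t).1
  rw [simpleIntegral_eq_mk hnull hX]
  calc (∫⁻ ω, ⨆ t, ‖X t ω‖ₑ ^ 2 ∂P) ^ (1 / 2 : ℝ)
    _ ≤ (4 * M.energy (Φ : M.OpFamily G) T) ^ (1 / 2 : ℝ) := by
      refine ENNReal.rpow_le_rpow (hdoob.trans_eq ?_) (by norm_num)
      rw [lintegral_enorm_sq_of_mem_integralRelation hnull hX]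
      rfl
    _ = 2 * M.lambdaNorm T (Φ : M.OpFamily G) := by
      rw [ENNReal.mul_rpow_of_nonneg _ _ (by norm_num), lambdaNorm,
        show (4 : ℝ≥0∞) = 2 ^ (2 : ℝ) by norm_num, ← ENNReal.rpow_mul]
      norm_num

end CylMartingaleMeasure

end

theorem mainTheorem3_general
    {Ω : Type*} {mΩ : MeasurableSpace Ω} (P : Measure Ω) [IsFiniteMeasure P]
    (ℱ : Filtration ℝ≥0 mΩ) (hnull : ∀ N : Set Ω, P N = 0 → MeasurableSet[ℱ 0] N)
    {H : Type*} [NormedAddCommGroup H] [InnerProductSpace ℝ H] [CompleteSpace H]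
    {G : Type*} [NormedAddCommGroup G] [InnerProductSpace ℝ G] [CompleteSpace G]
    [TopologicalSpace.SeparableSpace G]
    {U : Type*} [TopologicalSpace U] [MeasurableSpace U] [BorelSpace U]
    (M : CylMartingaleMeasure P ℱ H U) (T : ℝ≥0) :
    (∀ s t : ℝ≥0, s < t → t ≤ T → ∀ A ∈ M.ring, ∀ S : H →L[ℝ] G, IsHilbertSchmidt S →
      (∃ Y, M.IsRadonified T s t A S Y) ∧
      ∀ Y Y', M.IsRadonified T s t A S Y → M.IsRadonified T s t A S Y' →
        ∀ᵐ ω ∂P, ∀ r, Y r ω = Y' r ω) ∧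
    ∃ I : M.simpleIntegrands T G →ₗ[ℝ] M2 P ℱ T G,
      (∀ Φ : M.simpleIntegrands T G,
        (∃ X, M.IsSimpleIntegral T (Φ : M.OpFamily G) X) ∧
        ∀ X, M.IsSimpleIntegral T (Φ : M.OpFamily G) X →
          (∃ hX : X ∈ l2Martingales P ℱ T G, I Φ = Submodule.Quotient.mk ⟨X, hX⟩) ∧
          ∀ t : Iic T,
            ∫ ω, X t ω ∂P = 0 ∧
            ∫⁻ ω, ‖X t ω‖ₑ ^ 2 ∂P = M.energy (Φ : M.OpFamily G) t) ∧
      ∃ C : ℝ≥0, ∀ Φ : M.simpleIntegrands T G,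
        (I Φ).norm ≤ C * M.lambdaNorm T (Φ : M.OpFamily G) := by
  refine ⟨fun s t _ _ A hA S hS => ⟨M.exists_isRadonified hnull s t hA hS,
    fun Y Y' hY hY' => hY.ae_eq hY'⟩, M.simpleIntegral T G hnull, fun Φ =>
      ⟨M.exists_isSimpleIntegral hnull Φ.2, fun X hX => ?_⟩, 2, M.norm_simpleIntegral_le hnull⟩
  have hrel := M.mem_integralRelation_of_isSimpleIntegral hX
  have hmem := M.mem_l2Martingales_of_mem_integralRelation hnull hrel
  exact ⟨⟨hmem, M.simpleIntegral_eq_mk hnull hrel⟩, fun t =>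
    ⟨hmem.2 t, M.lintegral_enorm_sq_of_mem_integralRelation hnull hrel t⟩⟩

theorem mainTheorem3
    {Ω : Type*} {mΩ : MeasurableSpace Ω} (P : Measure Ω) [IsProbabilityMeasure P]
    (ℱ : Filtration ℝ≥0 mΩ) (hℱ : UsualConditions P ℱ)
    {H : Type*} [NormedAddCommGroup H] [InnerProductSpace ℝ H] [CompleteSpace H]
    [TopologicalSpace.SeparableSpace H]
    {G : Type*} [NormedAddCommGroup G] [InnerProductSpace ℝ G] [CompleteSpace G]
    [TopologicalSpace.SeparableSpace G]
    {U : Type*} [TopologicalSpace U] [MeasurableSpace U] [BorelSpace U]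
    (M : CylMartingaleMeasure P ℱ H U) (T : ℝ≥0) (hT : 0 < T) :
    -- the radonified processes exist and are unique up to indistinguishability
    (∀ s t : ℝ≥0, s < t → t ≤ T → ∀ A ∈ M.ring, ∀ S : H →L[ℝ] G, IsHilbertSchmidt S →
      (∃ Y, M.IsRadonified T s t A S Y) ∧
      ∀ Y Y', M.IsRadonified T s t A S Y → M.IsRadonified T s t A S Y' →
        ∀ᵐ ω ∂P, ∀ r, Y r ω = Y' r ω) ∧
    -- the integral processes define a continuous linear map into `M²_T(G)`
    ∃ I : M.simpleIntegrands T G →ₗ[ℝ] M2 P ℱ T G,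
      (∀ Φ : M.simpleIntegrands T G,
        (∃ X, M.IsSimpleIntegral T (Φ : M.OpFamily G) X) ∧
        ∀ X, M.IsSimpleIntegral T (Φ : M.OpFamily G) X →
          (∃ hX : X ∈ l2Martingales P ℱ T G, I Φ = Submodule.Quotient.mk ⟨X, hX⟩) ∧
          ∀ t : Iic T,
            ∫ ω, X t ω ∂P = 0 ∧
            ∫⁻ ω, ‖X t ω‖ₑ ^ 2 ∂P = M.energy (Φ : M.OpFamily G) t) ∧
      ∃ C : ℝ≥0, ∀ Φ : M.simpleIntegrands T G,
        (I Φ).norm ≤ C * M.lambdaNorm T (Φ : M.OpFamily G) :=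
  mainTheorem3_general P ℱ hℱ.null_mem M T
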